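/- Let $n,m\ge 1$ and let $\mathbb H^m=\mathbb C^m\times\mathbb R$ be the Heisenberg group with group law $(z,t)(z',t')=(z+z',\,t+t'-2x\cdot y'+2y\cdot x')$, where $z=x+iy$, $z'=x'+iy'$, and with the Korányi metric $d(p,q)=\|p^{-1}q\|$, $\|(z,t)\|=(|z|^4+t^2)^{1/4}$. For an open set $\Omega\subset\mathbb R^n$, let $W^{1,2}(\Omega,\mathbb H^m)$ be the set of Borel maps $f:\Omega\to\mathbb H^m$ such that $\int_\Omega d(f,P_0)^2\,dx<\infty$ for some $P_0\in\mathbb H^m$ and such that the Korevaar–Schoen energy $$E^2(f,\Omega)=\sup_{\varphi\in C_c(\Omega,[0,1])}\ \limsup_{\varepsilon\to0^+}\int_\Omega\varphi(p)\int_{\partial B_\varepsilon(p)}\Big(\frac{d(f(p),f(q))}{\varepsilon}\Big)^2\frac{d\sigma_\varepsilon(q)}{\varepsilon^{n-1}}\,dp$$ is finite; $f\in W^{1,2}_{loc}(\mathbb R^n,\mathbb H^m)$ means that $f\in W^{1,2}(V,\mathbb H^m)$ for every bounded open $V\subset\mathbb R^n$. If $f=(z,t)\in W^{1,2}_{loc}(\mathbb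 R^n,\mathbb H^m)$, then $z:\mathbb R^n\to\mathbb C^m$ is weakly differentiable with $|\nabla z|^2=\sum_{k,\beta}|\partial z^k/\partial x_\beta|^2\in L^1_{loc}(\mathbb R^n)$, and if $f\in W^{1,2}(\mathbb R^n,\mathbb H^m)$, then $|\nabla z|^2\in L^1(\mathbb R^n)$. Call $f$ a weak solution of the Euler–Lagrange system if for all $\gamma=1,\dots,n$ and all $\phi\in C_c^\infty(\mathbb R^n,\mathbb R)$ $$\int_{\mathbb R^n}\sum_{k=1}^m\Big(|\nabla z^k|^2\,\frac{\partial\phi}{\partial x_\gamma}-2\sum_{\beta=1}^n\frac{\partial z^k}{\partial x_\beta}\,\overline{\frac{\partial z^k}{\partial x_\gamma}}\,\frac{\partial\phi}{\partial x_\beta}\Big)dx=0 .$$ (a) If $f=(z,t)\in W^{1,2}_{loc}(\mathbb R^n,\mathbb H^m)$ is a weak solution of the Euler–Lagrange system and $$\lim_{r\to\infty}\frac1{r^{n-2}}\int_{B(0,r)}|\nabla z|^2\,dx=0,$$ then $|\nabla z|=0$ a.e. in $\mathbb R^n$. (b) If $n\neq2$ or $m=1$, and $f=(z,t)\in W^{1,2}(\mathbb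 R^n,\mathbb H^m)$ is a weak solution of the Euler–Lagrange system, then $|\nabla z|=0$ a.e. in $\mathbb R^n$. -/

import Mathlib

open MeasureTheory Filter Topology Set
open scoped ENNReal ComplexConjugate

/-- Euclidean space `ℝⁿ`. -/
abbrev Rn (n : ℕ) : Type := EuclideanSpace ℝ (Fin n)

/-- The underlying space `ℂᵐ × ℝ = ℝ²ᵐ⁺¹` of the Heisenberg group `ℍᵐ`: a point is `(z, t)` with
`z = x + i y`. The Korányi metric below induces the Euclidean topology, so that the Borel sets are
the usual ones. -/
abbrev Heis (m : ℕ) : Type := EuclideanSpace ℂ (Fin m) × ℝ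

/-- The group law `(x, y, t) (x', y', t') = (x + x', y + y', t + t' - 2 x · y' + 2 y · x')`. -/
def Heis.mul {m : ℕ} (p q : Heis m) : Heis m :=
  (p.1 + q.1,
    p.2 + q.2 - 2 * (∑ k, (p.1 k).re * (q.1 k).im) + 2 * (∑ k, (p.1 k).im * (q.1 k).re))

/-- The inverse in the Heisenberg group. -/
def Heis.inv {m : ℕ} (p : Heis m) : Heis m := (-p.1, -p.2)

/-- The Korányi gauge `((|x|² + |y|²)² + t²)^{1/4}`. -/
noncomputable def Heis.gauge {m : ℕ} (p : Heis m) : ℝ :=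
  ((‖p.1‖ ^ 2) ^ 2 + p.2 ^ 2) ^ (1 / 4 : ℝ)

/-- The Korányi metric `d(p, q) = ‖p⁻¹ q‖`. -/
noncomputable def Heis.kdist {m : ℕ} (p q : Heis m) : ℝ :=
  Heis.gauge (Heis.mul (Heis.inv p) q)

/-- `f ∈ L²(Ω, ℍᵐ)`: `f` is Borel measurable on `Ω` and `∫_Ω d(f, P₀)² < ∞` for some `P₀`. -/
def MemL2Heis {n m : ℕ} (f : Rn n → Heis m) (Ω : Set (Rn n)) : Prop :=
  Measurable (Ω.domRestrict f) ∧
    ∃ P₀ : Heis m, ∫⁻ p in Ω, ENNReal.ofReal (Heis.kdist (f p) P₀ ^ 2) < ∞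

/-- The boundary averaging Korevaar–Schoen density
`e_{f,ε}(p) = ∫_{∂B_ε(p)} (d(f(p), f(q)) / ε)² dσ_ε(q) / ε^{n-1}`, written on the unit sphere by
means of `q = p + ε ω`; here `volume.toSphere` is the surface measure of the unit sphere. -/
noncomputable def ksDensity {n m : ℕ} (f : Rn n → Heis m) (ε : ℝ) (p : Rn n) : ℝ≥0∞ :=
  ∫⁻ ω : Metric.sphere (0 : Rn n) 1,
    ENNReal.ofReal ((Heis.kdist (f p) (f (p + ε • (ω : Rn n))) / ε) ^ 2)
    ∂((volume : Measure (Rn n)).toSphere)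

/-- The Korevaar–Schoen energy `E²(f, Ω) = sup_φ limsup_{ε → 0⁺} ∫_Ω φ e_{f,ε}`, where `φ` runs
through the continuous functions with values in `[0, 1]` and compact support in `Ω`. (For such `φ`
and small `ε`, only values of `f` on `Ω` are used.) -/
noncomputable def ksEnergy {n m : ℕ} (f : Rn n → Heis m) (Ω : Set (Rn n)) : ℝ≥0∞ :=
  ⨆ (φ : Rn n → ℝ) (_ : Continuous φ) (_ : HasCompactSupport φ) (_ : tsupport φ ⊆ Ω)
    (_ : ∀ p, φ p ∈ Icc (0 : ℝ) 1),
    limsup (fun ε : ℝ => ∫⁻ p in Ω, ENNReal.ofReal (φ p) * ksDensity f ε p) (𝓝[>] 0)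

/-- `f ∈ W^{1,2}(Ω, ℍᵐ)`: `f ∈ L²(Ω, ℍᵐ)` has finite Korevaar–Schoen energy on `Ω`. -/
def MemW12 {n m : ℕ} (f : Rn n → Heis m) (Ω : Set (Rn n)) : Prop :=
  MemL2Heis f Ω ∧ ksEnergy f Ω < ∞

/-- `f ∈ W^{1,2}_loc(ℝⁿ, ℍᵐ)`: `f ∈ W^{1,2}(V, ℍᵐ)` for every bounded open set `V`. -/
def MemW12Loc {n m : ℕ} (f : Rn n → Heis m) : Prop :=
  ∀ V : Set (Rn n), IsOpen V → Bornology.IsBounded V → MemW12 f V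

/-- The partial derivative `∂φ/∂x_β` of a (smooth) function. -/
noncomputable def partialD {n : ℕ} (β : Fin n) (φ : Rn n → ℝ) (x : Rn n) : ℝ :=
  fderiv ℝ φ x (EuclideanSpace.single β 1)

/-- `G` is the weak (distributional) gradient of `z : ℝⁿ → ℂᵐ` on `ℝⁿ`; `G x β k` stands for
`∂z^k/∂x_β (x)`. -/
def HasWeakGradient {n m : ℕ} (z : Rn n → EuclideanSpace ℂ (Fin m))
    (G : Rn n → Fin n → EuclideanSpace ℂ (Fin m)) : Prop :=
  LocallyIntegrable z ∧ (∀ β, LocallyIntegrable (fun x => G x β)) ∧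
    ∀ φ : Rn n → ℝ, ContDiff ℝ (⊤ : ℕ∞) φ → HasCompactSupport φ → ∀ β,
      ∫ x, partialD β φ x • z x = - ∫ x, φ x • G x β

/-- `|∇z^k|² = ∑_β |∂z^k/∂x_β|²`. -/
noncomputable def gradSqComp {n m : ℕ} (G : Rn n → Fin n → EuclideanSpace ℂ (Fin m))
    (k : Fin m) (x : Rn n) : ℝ :=
  ∑ β, ‖G x β k‖ ^ 2

/-- `|∇z|² = ∑_k |∇z^k|²`. -/
noncomputable def gradSq {n m : ℕ} (G : Rn n → Fin n → EuclideanSpace ℂ (Fin m))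
    (x : Rn n) : ℝ :=
  ∑ k, gradSqComp G k x

/-- The weak Euler–Lagrange system on `ℝⁿ`, for the gradient `G = ∇z`: for all `γ` and all test
functions `φ = ξ^γ ∈ C_c^∞(ℝⁿ)`,
`∫ ∑_k (|∇z^k|² ∂φ/∂x_γ - 2 ∑_β (∂z^k/∂x_β) conj(∂z^k/∂x_γ) ∂φ/∂x_β) dx = 0`. -/
def SolvesEulerLagrange {n m : ℕ} (G : Rn n → Fin n → EuclideanSpace ℂ (Fin m)) : Prop :=
  ∀ (γ : Fin n) (φ : Rn n → ℝ), ContDiff ℝ (⊤ : ℕ∞) φ → HasCompactSupport φ →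
    ∫ x, ∑ k : Fin m, (((gradSqComp G k x * partialD γ φ x : ℝ) : ℂ)
      - 2 * ∑ β : Fin n, G x β k * conj (G x γ k) * (partialD β φ x : ℂ)) = 0

/-! The Euler–Lagrange system says that the stress-energy tensor T_βγ = δ_βγ |∇z|² − 2 ∑_k ∂_β z^k
conj(∂_γ z^k) is divergence free. Test functions are real, so this holds separately for its real
part, which is symmetric with trace (n − 2)|∇z|², and for its imaginary part, which is
antisymmetric.

For (a), testing with the radial field x cut off by `cutoff (c * ‖x‖ ^ 2)` leaves a
radial-derivative term of favourable sign (`monotonicity_ineq`). Hence c^((n-2)/2) ∫ |∇z|² `cutoff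
(c * ‖x‖ ^ 2)` is nonincreasing in c. With c = 1/r² it is at most the rescaled energy on B(0, r), so
the decay hypothesis forces it to vanish.

For (b), T is integrable, and its Fourier transform satisfies ∑_β ξ_β T̂_βγ(ξ) = 0
(`sum_mul_integral_comp_inner_eq_zero`). Letting ξ tend to 0 along e_γ gives ∫ T_γγ = 0, hence (n −
2) ∫ |∇z|² = 0. If n = 2, the symmetries of T turn the relation into a linear system that is
invertible for ξ ≠ 0, so T = 0; for m = 1 this says that ∂_0 z and ∂_1 z have equal modulus and zero
product.

The weak gradient exists because z is 1-Lipschitz for the Korányi metric. Difference quotients of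
its real components, averaged over the sphere against a suitable linear weight, converge weakly to
partial derivatives; the energy bounds these in L², and Riesz representation supplies the
derivative. Weak gradients are unique a.e., so the integrability found this way passes to any given
`G`. -/

/-! ### Radial cutoffs -/

/-- A smooth nonincreasing cutoff on the line, equal to `1` on `(-∞, 1/2]` and to `0` on
`[1, ∞)`. -/
noncomputable def cutoff (s : ℝ) : ℝ := Real.smoothTransition (2 - 2 * s)

theorem cutoff_contDiff : ContDiff ℝ (⊤ : ℕ∞) cutoff :=
  Real.smoothTransition.contDiff.comp (by fun_prop)

theorem cutoff_antitone : Antitone cutoff := fun a b hab =>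
  Real.smoothTransition.monotone (by linarith)

theorem cutoff_nonneg (s : ℝ) : 0 ≤ cutoff s := Real.smoothTransition.nonneg _

theorem cutoff_le_one (s : ℝ) : cutoff s ≤ 1 := Real.smoothTransition.le_one _

theorem cutoff_of_le {s : ℝ} (h : s ≤ 1 / 2) : cutoff s = 1 :=
  Real.smoothTransition.one_of_one_le (by linarith)

theorem cutoff_of_ge {s : ℝ} (h : 1 ≤ s) : cutoff s = 0 :=
  Real.smoothTransition.zero_of_nonpos (by linarith)

theorem cutoff_hasDerivAt (s : ℝ) : HasDerivAt cutoff (deriv cutoff s) s :=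
  (cutoff_contDiff.differentiable (by simp) s).hasDerivAt

theorem continuous_deriv_cutoff : Continuous (deriv cutoff) :=
  cutoff_contDiff.continuous_deriv (by simp)

theorem deriv_cutoff_nonpos (s : ℝ) : deriv cutoff s ≤ 0 := cutoff_antitone.deriv_nonpos

theorem deriv_cutoff_of_lt {s : ℝ} (h : s < 1 / 2) : deriv cutoff s = 0 := by
  have : cutoff =ᶠ[𝓝 s] fun _ => 1 := by
    filter_upwards [Iio_mem_nhds h] with t ht using cutoff_of_le (le_of_lt ht)
  rw [this.deriv_eq]; simp

theorem deriv_cutoff_of_gt {s : ℝ} (h : 1 < s) : deriv cutoff s = 0 := by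
  have : cutoff =ᶠ[𝓝 s] fun _ => 0 := by
    filter_upwards [Ioi_mem_nhds h] with t ht using cutoff_of_ge (le_of_lt ht)
  rw [this.deriv_eq]; simp

theorem exists_deriv_cutoff_bound : ∃ C, 0 ≤ C ∧ ∀ s, |deriv cutoff s| ≤ C := by
  have : HasCompactSupport (deriv cutoff) := by
    refine HasCompactSupport.intro (isCompact_Icc (a := (1 / 2 : ℝ)) (b := 1)) fun s hs => ?_
    by_cases h : s < 1 / 2
    · exact deriv_cutoff_of_lt h
    · refine deriv_cutoff_of_gt ?_
      by_contra h'
      exact hs ⟨not_lt.1 h, not_lt.1 h'⟩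
  obtain ⟨C, hC⟩ := this.exists_bound_of_continuous continuous_deriv_cutoff
  exact ⟨C, (norm_nonneg _).trans (hC 0), hC⟩

theorem cutoff_normSq_contDiff {n : ℕ} (c : ℝ) :
    ContDiff ℝ (⊤ : ℕ∞) (fun x : Rn n => cutoff (c * ‖x‖ ^ 2)) :=
  cutoff_contDiff.comp (contDiff_const.mul (contDiff_norm_sq ℝ))

theorem cutoff_normSq_hasCompactSupport {n : ℕ} {c : ℝ} (hc : 0 < c) :
    HasCompactSupport (fun x : Rn n => cutoff (c * ‖x‖ ^ 2)) := by
  refine HasCompactSupport.intro (isCompact_closedBall (0 : Rn n) (1 / c + 1)) fun x hx => ?_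
  apply cutoff_of_ge
  have h1 : 1 / c + 1 < ‖x‖ := by simpa using hx
  have h2 : 0 < 1 / c := by positivity
  have h3 : 1 / c ≤ ‖x‖ ^ 2 := by nlinarith
  calc 1 = c * (1 / c) := by field_simp
    _ ≤ _ := by gcongr

theorem cutoff_normSq_hasFDerivAt {n : ℕ} (c : ℝ) (x : Rn n) :
    HasFDerivAt (fun x : Rn n => cutoff (c * ‖x‖ ^ 2))
      (deriv cutoff (c * ‖x‖ ^ 2) • (c • (2 • innerSL ℝ x))) x := by
  have h := (hasStrictFDerivAt_norm_sq x).hasFDerivAt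
  exact HasDerivAt.comp_hasFDerivAt (h₂ := cutoff) x (cutoff_hasDerivAt (c * ‖x‖ ^ 2))
    (h.const_mul c)

theorem abs_coord_le_norm {n : ℕ} (x : Rn n) (β : Fin n) : |x β| ≤ ‖x‖ := by
  simpa using PiLp.norm_apply_le x β

theorem partialD_mul_cutoff {n : ℕ} {h : Rn n → ℝ} (c : ℝ) (x : Rn n)
    (hh : DifferentiableAt ℝ h x) (β : Fin n) :
    partialD β (fun x => h x * cutoff (c * ‖x‖ ^ 2)) x =
      partialD β h x * cutoff (c * ‖x‖ ^ 2)
        + h x * (deriv cutoff (c * ‖x‖ ^ 2) * (2 * c * x β)) := by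
  have := hh.hasFDerivAt.mul (cutoff_normSq_hasFDerivAt c x)
  unfold partialD
  rw [show (fun x => h x * cutoff (c * ‖x‖ ^ 2)) = h * fun x => cutoff (c * ‖x‖ ^ 2) from rfl,
    this.fderiv]
  simp [EuclideanSpace.inner_single_right]
  ring

/-- The derivative is zero unless c‖x‖² ≤ 1, and there (c‖x‖)² ≤ c ≤ 1. Uniformity in c and x allows
dominated convergence as c → 0. -/
theorem abs_deriv_cutoff_mul_coord_le {n : ℕ} {C c : ℝ} (hC : 0 ≤ C)
    (hb : ∀ s, |deriv cutoff s| ≤ C) (hc : 0 ≤ c) (hc1 : c ≤ 1) (x : Rn n) (β : Fin n) :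
    |deriv cutoff (c * ‖x‖ ^ 2) * (2 * c * x β)| ≤ 2 * C := by
  by_cases h : 1 < c * ‖x‖ ^ 2
  · rw [deriv_cutoff_of_gt h]; simpa using hC
  · have h1 : c * |x β| ≤ 1 := by
      have h3 : c * |x β| ≤ c * ‖x‖ := by gcongr; exact abs_coord_le_norm x β
      have h4 : (c * ‖x‖) ^ 2 ≤ 1 := by
        calc (c * ‖x‖) ^ 2 = c * (c * ‖x‖ ^ 2) := by ring
          _ ≤ 1 * 1 := by gcongr; exact not_lt.1 h
          _ = 1 := by ring
      have h5 : 0 ≤ c * ‖x‖ := by positivity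
      nlinarith
    calc _ = |deriv cutoff (c * ‖x‖ ^ 2)| * (2 * (c * |x β|)) := by
          rw [abs_mul, abs_mul, abs_mul, abs_of_nonneg hc, abs_two]; ring
      _ ≤ C * (2 * 1) := by gcongr; exact hb _
      _ = 2 * C := by ring

/-! ### Fourier analysis of integrable divergence-free fields -/

/-- Testing a divergence free integrable vector field with `g ⟪ξ, x⟫`. -/
theorem sum_mul_integral_comp_inner_eq_zero {n : ℕ} {T : Fin n → Rn n → ℝ}
    (hT : ∀ β, Integrable (T β))
    (h : ∀ φ : Rn n → ℝ, ContDiff ℝ (⊤ : ℕ∞) φ → HasCompactSupport φ →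
      ∫ x, ∑ β, T β x * partialD β φ x = 0)
    {g g' : ℝ → ℝ} (hg : ContDiff ℝ (⊤ : ℕ∞) g) (hg' : ∀ s, HasDerivAt g (g' s) s)
    (hgc : Continuous g')
    (hb : ∀ s, |g s| ≤ 1) (hb' : ∀ s, |g' s| ≤ 1) (ξ : Rn n) :
    ∑ β, ξ β * ∫ x, T β x * g' (inner ℝ ξ x) = 0 := by
  obtain ⟨C, hC0, hC⟩ := exists_deriv_cutoff_bound
  -- The function g(⟨ξ, x⟩) lacks compact support, so it is multiplied by cutoffs with c → 0, whose
  -- gradients tend to 0 pointwise and stay bounded.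
  set c : ℕ → ℝ := fun k => 1 / ((k : ℝ) + 1) with hc
  have hc0 : ∀ k, 0 < c k := fun k => by simp only [hc]; positivity
  have hc1 : ∀ k, c k ≤ 1 := fun k => by
    simp only [hc]; rw [div_le_one (by positivity)]; linarith [(Nat.cast_nonneg k : (0 : ℝ) ≤ k)]
  have hct : Tendsto c atTop (𝓝 0) := tendsto_one_div_add_atTop_nhds_zero_nat
  have hin : ∀ x, HasFDerivAt (fun x : Rn n => g (inner ℝ ξ x))
      (g' (inner ℝ ξ x) • innerSL ℝ ξ) x := fun x =>
    (hg' _).comp_hasFDerivAt x (innerSL ℝ ξ).hasFDerivAt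
  have hpd : ∀ β x, partialD β (fun x : Rn n => g (inner ℝ ξ x)) x = g' (inner ℝ ξ x) * ξ β := by
    intro β x
    unfold partialD
    rw [(hin x).fderiv]
    simp [EuclideanSpace.inner_single_right]
  have hg'm : Continuous fun x : Rn n => g' (inner ℝ ξ x) := by fun_prop
  have hgm : Continuous fun x : Rn n => g (inner ℝ ξ x) := hg.continuous.comp (by fun_prop)
  have hcm : ∀ k, Continuous fun x : Rn n => cutoff (c k * ‖x‖ ^ 2) := fun k =>
    (cutoff_normSq_contDiff (c k)).continuous
  have hdm : ∀ k, Continuous fun x : Rn n => deriv cutoff (c k * ‖x‖ ^ 2) := fun k =>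
    continuous_deriv_cutoff.comp (by fun_prop)
  set F : ℕ → Rn n → ℝ := fun k x => ∑ β, T β x *
    (g' (inner ℝ ξ x) * ξ β * cutoff (c k * ‖x‖ ^ 2)
        + g (inner ℝ ξ x) * (deriv cutoff (c k * ‖x‖ ^ 2) * (2 * c k * x β))) with hF
  have hF0 : ∀ k, ∫ x, F k x = 0 := by
    intro k
    have h1 := h (fun x => g (inner ℝ ξ x) * cutoff (c k * ‖x‖ ^ 2))
      ((hg.comp (innerSL ℝ ξ).contDiff).mul (cutoff_normSq_contDiff _))
      ((cutoff_normSq_hasCompactSupport (hc0 k)).mul_left)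
    rw [← h1]
    congr 1
    ext x
    simp only [hF]
    refine Finset.sum_congr rfl fun β _ => ?_
    rw [partialD_mul_cutoff _ _ (hin x).differentiableAt, hpd]
  have hlim : Tendsto (fun k => ∫ x, F k x) atTop
      (𝓝 (∫ x, ∑ β, T β x * (g' (inner ℝ ξ x) * ξ β))) := by
    refine tendsto_integral_of_dominated_convergence
      (fun x => ∑ β, |T β x| * (|ξ β| + 2 * C)) (fun k => ?_) ?_ (fun k => ?_) ?_
    · refine Finset.aestronglyMeasurable_fun_sum _ fun β _ => (hT β).1.mul ?_
      refine Continuous.aestronglyMeasurable ?_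
      have := hcm k
      have := hdm k
      fun_prop
    · exact integrable_finsetSum _ fun β _ => (hT β).abs.mul_const _
    · refine Eventually.of_forall fun x => ?_
      simp only [hF, Real.norm_eq_abs]
      refine (Finset.abs_sum_le_sum_abs _ _).trans (Finset.sum_le_sum fun β _ => ?_)
      rw [abs_mul]
      refine mul_le_mul_of_nonneg_left ?_ (abs_nonneg _)
      refine (abs_add_le _ _).trans (add_le_add ?_ ?_)
      · rw [abs_mul, abs_mul, abs_of_nonneg (cutoff_nonneg _)]
        calc _ ≤ 1 * |ξ β| * 1 := by
              gcongr
              · exact cutoff_nonneg _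
              · exact hb' _
              · exact cutoff_le_one _
          _ = _ := by ring
      · rw [abs_mul]
        calc _ ≤ 1 * (2 * C) := by
              gcongr
              · exact hb _
              · exact abs_deriv_cutoff_mul_coord_le hC0 hC (hc0 k).le (hc1 k) x β
          _ = _ := by ring
    · refine Eventually.of_forall fun x => ?_
      simp only [hF]
      refine tendsto_finsetSum _ fun β _ => Tendsto.const_mul _ ?_
      have hs : Tendsto (fun k => c k * ‖x‖ ^ 2) atTop (𝓝 0) := by simpa using hct.mul_const _
      have h1 : Tendsto (fun k => cutoff (c k * ‖x‖ ^ 2)) atTop (𝓝 1) := by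
        have := (cutoff_contDiff.continuous.tendsto 0).comp hs
        rwa [cutoff_of_le (by norm_num)] at this
      have h2 : Tendsto (fun k => deriv cutoff (c k * ‖x‖ ^ 2)) atTop (𝓝 (deriv cutoff 0)) :=
        (continuous_deriv_cutoff.tendsto 0).comp hs
      have h3 : Tendsto (fun k => 2 * c k * x β) atTop (𝓝 0) := by
        simpa using (hct.const_mul 2).mul_const (x β)
      simpa using (h1.const_mul (g' (inner ℝ ξ x) * ξ β)).add
        ((h2.mul h3).const_mul (g (inner ℝ ξ x)))
  simp only [hF0] at hlim
  have h0 := tendsto_nhds_unique hlim tendsto_const_nhds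
  rw [integral_finsetSum] at h0
  · rw [← h0]
    refine Finset.sum_congr rfl fun β _ => ?_
    rw [← integral_const_mul]
    congr 1; ext x; ring
  · intro β _
    refine Integrable.mul_bdd (c := |ξ β|) (hT β) ?_ ?_
    · exact (hg'm.mul continuous_const).aestronglyMeasurable
    · refine Eventually.of_forall fun x => ?_
      rw [norm_mul]
      calc _ ≤ 1 * |ξ β| := by gcongr; exacts [hb' _, le_rfl]
        _ = _ := one_mul _

/-- An integrable function is determined by its Fourier transform. -/
theorem ae_eq_zero_of_integral_cos_sin {n : ℕ} {T : Rn n → ℝ} (hT : Integrable T)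
    (hcos : ∀ ξ, ∫ x, T x * Real.cos (inner ℝ ξ x) = 0)
    (hsin : ∀ ξ, ∫ x, T x * Real.sin (inner ℝ ξ x) = 0) : T =ᵐ[volume] 0 := by
  -- T⁺ and T⁻ are densities of finite measures with the same characteristic function. The densities
  -- then agree a.e., and since one of them is zero at each point, both are.
  have hp : AEMeasurable (fun x => ENNReal.ofReal (T x)) := hT.1.aemeasurable.ennreal_ofReal
  have hm : AEMeasurable (fun x => ENNReal.ofReal (-T x)) := hT.neg.1.aemeasurable.ennreal_ofReal
  have hpf : ∫⁻ x, ENNReal.ofReal (T x) ≠ ∞ := hT.lintegral_lt_top.ne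
  have hmf : ∫⁻ x, ENNReal.ofReal (-T x) ≠ ∞ := hT.neg.lintegral_lt_top.ne
  have : IsFiniteMeasure (volume.withDensity fun x => ENNReal.ofReal (T x)) :=
    isFiniteMeasure_withDensity hpf
  have : IsFiniteMeasure (volume.withDensity fun x => ENNReal.ofReal (-T x)) :=
    isFiniteMeasure_withDensity hmf
  have key : (volume.withDensity fun x => ENNReal.ofReal (T x)) =
      volume.withDensity fun x => ENNReal.ofReal (-T x) := by
    refine Measure.ext_of_charFun (funext fun ξ => ?_)
    rw [charFun_apply, charFun_apply, integral_withDensity_eq_integral_toReal_smul₀ hp (by simp),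
      integral_withDensity_eq_integral_toReal_smul₀ hm (by simp), ← sub_eq_zero]
    have he : ∀ x : Rn n, ‖Complex.exp ((inner ℝ x ξ : ℝ) * Complex.I)‖ ≤ 1 := fun x =>
      (Complex.norm_exp_ofReal_mul_I _).le
    have hec : Continuous fun x : Rn n => Complex.exp ((inner ℝ x ξ : ℝ) * Complex.I) := by
      fun_prop
    have hi : ∀ S : Rn n → ℝ, Integrable S →
        Integrable fun x => S x • Complex.exp ((inner ℝ x ξ : ℝ) * Complex.I) := by
      intro S hS
      exact Integrable.smul_bdd hS 1 hec.aestronglyMeasurable (Eventually.of_forall he)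
    have h1 := hi _ hT.pos_part
    have h2 := hi _ hT.neg_part
    simp only [ENNReal.toReal_ofReal']
    rw [← integral_sub h1 h2]
    have : ∀ x, max (T x) 0 • Complex.exp ((inner ℝ x ξ : ℝ) * Complex.I)
        - max (-T x) 0 • Complex.exp ((inner ℝ x ξ : ℝ) * Complex.I)
        = T x • Complex.exp ((inner ℝ x ξ : ℝ) * Complex.I) := by
      intro x
      rw [← sub_smul]
      congr 1
      rcases le_total 0 (T x) with h | h
      · rw [max_eq_left h, max_eq_right (by linarith)]; ring
      · rw [max_eq_right h, max_eq_left (by linarith)]; ring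
    simp only [this]
    have hint := hi T hT
    apply Complex.ext
    · have := integral_re hint
      simp only [RCLike.re_eq_complex_re] at this
      rw [← this, Complex.zero_re, ← hcos ξ]
      congr 1; ext x
      rw [Complex.real_smul, Complex.re_ofReal_mul, Complex.exp_ofReal_mul_I_re, real_inner_comm]
    · have := integral_im hint
      simp only [RCLike.im_eq_complex_im] at this
      rw [← this, Complex.zero_im, ← hsin ξ]
      congr 1; ext x
      rw [Complex.real_smul, Complex.im_ofReal_mul, Complex.exp_ofReal_mul_I_im, real_inner_comm]
  have h3 := (withDensity_eq_iff hp hm hpf).1 key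
  filter_upwards [h3] with x hx
  rcases lt_trichotomy (T x) 0 with h | h | h
  · rw [ENNReal.ofReal_of_nonpos h.le] at hx
    exact absurd (ENNReal.ofReal_eq_zero.1 hx.symm) (by linarith)
  · exact h
  · rw [ENNReal.ofReal_of_nonpos (p := -T x) (by linarith)] at hx
    exact absurd (ENNReal.ofReal_eq_zero.1 hx) (by linarith)

/-- Needed to reach the frequency ξ = 0, where the divergence relation carries no information. -/
theorem continuous_integral_mul_comp_inner {n : ℕ} {T : Rn n → ℝ} (hT : Integrable T)
    {g : ℝ → ℝ} (hg : Continuous g) (hb : ∀ s, |g s| ≤ 1) :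
    Continuous fun ξ : Rn n => ∫ x, T x * g (inner ℝ ξ x) := by
  refine continuous_of_dominated (bound := fun x => |T x|) (fun ξ => ?_) (fun ξ => ?_) hT.abs ?_
  · exact hT.1.mul (Continuous.aestronglyMeasurable (by fun_prop))
  · refine Eventually.of_forall fun x => ?_
    rw [norm_mul]
    calc _ ≤ |T x| * 1 := by gcongr; exacts [le_rfl, hb _]
      _ = _ := mul_one _
  · exact Eventually.of_forall fun x => by fun_prop


/-! ### The stress-energy tensor -/

section Tensor

variable {n m : ℕ} {G : Rn n → Fin n → EuclideanSpace ℂ (Fin m)}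

/-- The real part `δ_{βγ} |∇z|² - 2 ∑_k Re (∂_β z^k conj (∂_γ z^k))` of the stress-energy
tensor. -/
noncomputable def stressRe (G : Rn n → Fin n → EuclideanSpace ℂ (Fin m)) (β γ : Fin n)
    (x : Rn n) : ℝ :=
  (if β = γ then gradSq G x else 0) - 2 * ∑ k, (G x β k * conj (G x γ k)).re

/-- The imaginary part `∑_k Im (∂_β z^k conj (∂_γ z^k))` of the stress-energy tensor, up to a
factor. -/
noncomputable def stressIm (G : Rn n → Fin n → EuclideanSpace ℂ (Fin m)) (β γ : Fin n)
    (x : Rn n) : ℝ :=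
  ∑ k, (G x β k * conj (G x γ k)).im

theorem gradSqComp_nonneg (k : Fin m) (x : Rn n) : 0 ≤ gradSqComp G k x :=
  Finset.sum_nonneg fun _ _ => sq_nonneg _

theorem gradSqComp_le_gradSq (k : Fin m) (x : Rn n) : gradSqComp G k x ≤ gradSq G x :=
  Finset.single_le_sum (f := fun k => gradSqComp G k x) (fun k _ => gradSqComp_nonneg k x)
    (Finset.mem_univ k)

theorem gradSq_nonneg (x : Rn n) : 0 ≤ gradSq G x :=
  Finset.sum_nonneg fun k _ => gradSqComp_nonneg k x

theorem normSq_le_gradSq (β : Fin n) (k : Fin m) (x : Rn n) : ‖G x β k‖ ^ 2 ≤ gradSq G x :=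
  (Finset.single_le_sum (f := fun β => ‖G x β k‖ ^ 2) (fun _ _ => sq_nonneg _)
    (Finset.mem_univ β)).trans (gradSqComp_le_gradSq k x)

/-- By 2ab ≤ a² + b². Every entry of the tensor thus inherits the integrability of the energy
density. -/
theorem norm_mul_conj_le_gradSq (β γ : Fin n) (k : Fin m) (x : Rn n) :
    ‖G x β k * conj (G x γ k)‖ ≤ gradSq G x := by
  rw [norm_mul, RCLike.norm_conj]
  nlinarith [normSq_le_gradSq (G := G) β k x, normSq_le_gradSq (G := G) γ k x,
    sq_nonneg (‖G x β k‖ - ‖G x γ k‖)]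

theorem gradSq_aestronglyMeasurable
    (hG : ∀ β k, AEStronglyMeasurable (fun x => G x β k) volume) :
    AEStronglyMeasurable (gradSq G) volume :=
  Finset.aestronglyMeasurable_fun_sum _ fun k _ =>
    Finset.aestronglyMeasurable_fun_sum _ fun β _ => (hG β k).norm.pow 2

theorem mul_conj_aestronglyMeasurable
    (hG : ∀ β k, AEStronglyMeasurable (fun x => G x β k) volume) (β γ : Fin n) (k : Fin m) :
    AEStronglyMeasurable (fun x => G x β k * conj (G x γ k)) volume :=
  (hG β k).mul (Complex.continuous_conj.comp_aestronglyMeasurable (hG γ k))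

theorem mul_conj_locallyIntegrable
    (hG : ∀ β k, AEStronglyMeasurable (fun x => G x β k) volume)
    (he : LocallyIntegrable (gradSq G)) (β γ : Fin n) (k : Fin m) :
    LocallyIntegrable (fun x => G x β k * conj (G x γ k)) :=
  he.mono (mul_conj_aestronglyMeasurable hG β γ k) (Eventually.of_forall fun x =>
    (norm_mul_conj_le_gradSq β γ k x).trans (le_abs_self _))

theorem mul_conj_integrable
    (hG : ∀ β k, AEStronglyMeasurable (fun x => G x β k) volume)
    (he : Integrable (gradSq G)) (β γ : Fin n) (k : Fin m) :
    Integrable (fun x => G x β k * conj (G x γ k)) :=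
  he.mono (mul_conj_aestronglyMeasurable hG β γ k) (Eventually.of_forall fun x =>
    (norm_mul_conj_le_gradSq β γ k x).trans (le_abs_self _))

theorem stressRe_integrable
    (hG : ∀ β k, AEStronglyMeasurable (fun x => G x β k) volume)
    (he : Integrable (gradSq G)) (β γ : Fin n) : Integrable (stressRe G β γ) := by
  refine Integrable.sub ?_ (Integrable.const_mul (integrable_finsetSum _ fun k _ =>
    (mul_conj_integrable hG he β γ k).re) _)
  split_ifs
  · exact he
  · exact integrable_zero _ _ _

theorem stressIm_integrable
    (hG : ∀ β k, AEStronglyMeasurable (fun x => G x β k) volume)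
    (he : Integrable (gradSq G)) (β γ : Fin n) : Integrable (stressIm G β γ) :=
  integrable_finsetSum _ fun k _ => (mul_conj_integrable hG he β γ k).im

theorem continuous_partialD {φ : Rn n → ℝ} (hφ : ContDiff ℝ (⊤ : ℕ∞) φ) (β : Fin n) :
    Continuous (partialD β φ) :=
  (hφ.continuous_fderiv (by simp)).clm_apply continuous_const

theorem hasCompactSupport_partialD {φ : Rn n → ℝ} (hφ : HasCompactSupport φ) (β : Fin n) :
    HasCompactSupport (partialD β φ) :=
  hφ.fderiv_apply ℝ _

theorem eulerLagrange_integrand_re (γ : Fin n) (d : Fin n → ℝ) (x : Rn n) :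
    (∑ k : Fin m, (((gradSqComp G k x * d γ : ℝ) : ℂ)
      - 2 * ∑ β : Fin n, G x β k * conj (G x γ k) * (d β : ℂ))).re
      = ∑ β, stressRe G β γ x * d β := by
  simp only [stressRe, sub_mul, Finset.sum_sub_distrib, ite_mul, zero_mul, Finset.sum_ite_eq',
    Finset.mem_univ, if_true, Complex.sub_re, Complex.re_sum, Complex.ofReal_re]
  congr 1
  · rw [gradSq, Finset.sum_mul]
  · have : ∀ k, (2 * ∑ β : Fin n, G x β k * conj (G x γ k) * (d β : ℂ)).re
        = ∑ β, 2 * ((G x β k * conj (G x γ k)).re * d β) := by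
      intro k
      rw [show (2 : ℂ) = ((2 : ℝ) : ℂ) by norm_num, Complex.re_ofReal_mul, Complex.re_sum,
        Finset.mul_sum]
      simp only [Complex.re_mul_ofReal]
    simp only [this]
    rw [Finset.sum_comm]
    refine Finset.sum_congr rfl fun β _ => ?_
    rw [← Finset.mul_sum, ← Finset.sum_mul]; ring

theorem eulerLagrange_integrand_im (γ : Fin n) (d : Fin n → ℝ) (x : Rn n) :
    (∑ k : Fin m, (((gradSqComp G k x * d γ : ℝ) : ℂ)
      - 2 * ∑ β : Fin n, G x β k * conj (G x γ k) * (d β : ℂ))).im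
      = -2 * ∑ β, stressIm G β γ x * d β := by
  simp only [stressIm, Finset.sum_sub_distrib, Complex.sub_im, Complex.im_sum, Complex.ofReal_im]
  have : ∀ k, (2 * ∑ β : Fin n, G x β k * conj (G x γ k) * (d β : ℂ)).im
      = ∑ β, 2 * ((G x β k * conj (G x γ k)).im * d β) := by
    intro k
    rw [show (2 : ℂ) = ((2 : ℝ) : ℂ) by norm_num, Complex.im_ofReal_mul, Complex.im_sum,
      Finset.mul_sum]
    simp only [Complex.im_mul_ofReal]
  simp only [this, Finset.sum_const_zero]
  rw [Finset.sum_comm, zero_sub, Finset.mul_sum, ← Finset.sum_neg_distrib]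
  refine Finset.sum_congr rfl fun β _ => ?_
  rw [← Finset.mul_sum, ← Finset.sum_mul]; ring

/-- Integrability is what permits taking real and imaginary parts under the integral sign. -/
theorem eulerLagrange_integrand_integrable
    (hG : ∀ β k, AEStronglyMeasurable (fun x => G x β k) volume)
    (he : LocallyIntegrable (gradSq G)) (γ : Fin n) {φ : Rn n → ℝ}
    (hφ : ContDiff ℝ (⊤ : ℕ∞) φ) (hc : HasCompactSupport φ) :
    Integrable fun x => ∑ k : Fin m, (((gradSqComp G k x * partialD γ φ x : ℝ) : ℂ)
      - 2 * ∑ β : Fin n, G x β k * conj (G x γ k) * (partialD β φ x : ℂ)) := by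
  refine integrable_finsetSum _ fun k _ => Integrable.sub ?_ (Integrable.const_mul
    (integrable_finsetSum _ fun β _ => ?_) _)
  · refine Integrable.ofReal ?_
    have : LocallyIntegrable (gradSqComp G k) := he.mono
      (Finset.aestronglyMeasurable_fun_sum _ fun β _ => (hG β k).norm.pow 2)
      (Eventually.of_forall fun x => by
        rw [Real.norm_of_nonneg (gradSqComp_nonneg k x), Real.norm_of_nonneg (gradSq_nonneg x)]
        exact gradSqComp_le_gradSq k x)
    exact this.integrable_smul_right_of_hasCompactSupport (continuous_partialD hφ γ)
      (hasCompactSupport_partialD hc γ)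
  · exact (mul_conj_locallyIntegrable hG he β γ k).integrable_smul_right_of_hasCompactSupport
      (Complex.continuous_ofReal.comp (continuous_partialD hφ β))
      ((hasCompactSupport_partialD hc β).comp_left Complex.ofReal_zero)

theorem SolvesEulerLagrange.stressRe (h : SolvesEulerLagrange G)
    (hG : ∀ β k, AEStronglyMeasurable (fun x => G x β k) volume)
    (he : LocallyIntegrable (gradSq G)) (γ : Fin n) {φ : Rn n → ℝ}
    (hφ : ContDiff ℝ (⊤ : ℕ∞) φ) (hc : HasCompactSupport φ) :
    ∫ x, ∑ β, stressRe G β γ x * partialD β φ x = 0 := by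
  have h1 := integral_re (eulerLagrange_integrand_integrable hG he γ hφ hc)
  rw [h γ φ hφ hc] at h1
  simp only [RCLike.re_eq_complex_re, Complex.zero_re] at h1
  rw [← h1]
  congr 1; ext x
  exact (eulerLagrange_integrand_re γ (fun β => partialD β φ x) x).symm

theorem SolvesEulerLagrange.stressIm (h : SolvesEulerLagrange G)
    (hG : ∀ β k, AEStronglyMeasurable (fun x => G x β k) volume)
    (he : LocallyIntegrable (gradSq G)) (γ : Fin n) {φ : Rn n → ℝ}
    (hφ : ContDiff ℝ (⊤ : ℕ∞) φ) (hc : HasCompactSupport φ) :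
    ∫ x, ∑ β, stressIm G β γ x * partialD β φ x = 0 := by
  have h1 := integral_im (eulerLagrange_integrand_integrable hG he γ hφ hc)
  rw [h γ φ hφ hc] at h1
  simp only [RCLike.im_eq_complex_im, Complex.zero_im] at h1
  have h2 : ∫ x, -2 * ∑ β, _root_.stressIm G β γ x * partialD β φ x = 0 := by
    rw [← h1]
    congr 1; ext x
    exact (eulerLagrange_integrand_im γ (fun β => partialD β φ x) x).symm
  rw [integral_const_mul] at h2
  simpa using h2

theorem stressRe_self (γ : Fin n) (x : Rn n) :
    stressRe G γ γ x = gradSq G x - 2 * ∑ k, ‖G x γ k‖ ^ 2 := by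
  simp only [stressRe, if_true]
  congr 2
  refine Finset.sum_congr rfl fun k _ => ?_
  rw [Complex.mul_conj, Complex.ofReal_re, Complex.normSq_eq_norm_sq]

/-- The diagonal term contributes n copies of the energy density, the quadratic term removes two.
This factor makes dimension 2 exceptional. -/
theorem sum_stressRe_self (x : Rn n) : ∑ γ, stressRe G γ γ x = (n - 2) * gradSq G x := by
  simp only [stressRe_self, Finset.sum_sub_distrib, ← Finset.mul_sum]
  rw [Finset.sum_comm]
  simp [gradSq, gradSqComp]
  ring

/-! ### Vanishing for finite energy -/

/-- A solution of the Euler–Lagrange system with finite energy vanishes unless `n = 2`. -/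
theorem SolvesEulerLagrange.gradSq_eq_zero_of_ne_two (h : SolvesEulerLagrange G)
    (hG : ∀ β k, AEStronglyMeasurable (fun x => G x β k) volume)
    (he : Integrable (gradSq G)) (hn : n ≠ 2) : ∀ᵐ x, gradSq G x = 0 := by
  -- At ξ = s e_γ only β = γ survives, so the cosine transform of T_γγ vanishes there for s ≠ 0. Its
  -- limit as s → 0 is ∫ T_γγ.
  have key : ∀ γ, ∫ x, _root_.stressRe G γ γ x = 0 := by
    intro γ
    have hc := continuous_integral_mul_comp_inner (stressRe_integrable hG he γ γ)
      Real.continuous_cos Real.abs_cos_le_one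
    have hz : ∀ s : ℝ, s ≠ 0 →
        ∫ x, _root_.stressRe G γ γ x * Real.cos (inner ℝ (s • EuclideanSpace.single γ 1) x) = 0 := by
      intro s hs
      have := sum_mul_integral_comp_inner_eq_zero
        (fun β => stressRe_integrable hG he β γ) (fun φ hφ hc => h.stressRe hG he.locallyIntegrable
          γ hφ hc) Real.contDiff_sin Real.hasDerivAt_sin Real.continuous_cos Real.abs_sin_le_one
        Real.abs_cos_le_one (s • EuclideanSpace.single γ 1)
      rw [Finset.sum_eq_single γ] at this
      · simpa [hs] using this
      · intro β _ hβ
        simp [hβ]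
      · simp
    have ht : Tendsto (fun s : ℝ => ∫ x, _root_.stressRe G γ γ x *
        Real.cos (inner ℝ (s • EuclideanSpace.single γ 1) x)) (𝓝[≠] 0)
        (𝓝 (∫ x, _root_.stressRe G γ γ x *
          Real.cos (inner ℝ ((0 : ℝ) • EuclideanSpace.single γ (1 : ℝ)) x))) :=
      ((hc.comp (by fun_prop : Continuous fun s : ℝ => s • EuclideanSpace.single γ (1 : ℝ))).tendsto
        0).mono_left nhdsWithin_le_nhds
    have h0 := tendsto_nhds_unique ht
      (tendsto_const_nhds.congr' (eventually_mem_nhdsWithin.mono fun s hs => (hz s hs).symm))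
    simpa using h0
  have h1 : ∫ x, ∑ γ, _root_.stressRe G γ γ x = 0 := by
    rw [integral_finsetSum _ fun γ _ => stressRe_integrable hG he γ γ]
    simp [key]
  simp only [sum_stressRe_self] at h1
  rw [integral_const_mul] at h1
  have hn' : (n : ℝ) - 2 ≠ 0 := fun h' => hn (by exact_mod_cast sub_eq_zero.1 h')
  have h2 := (mul_eq_zero.1 h1).resolve_left hn'
  exact (integral_eq_zero_iff_of_nonneg (fun x => gradSq_nonneg x) he).1 h2

/-- A scalar solution of the Euler–Lagrange system with finite energy on the plane vanishes. -/
theorem SolvesEulerLagrange.gradSq_eq_zero_of_two {G : Rn 2 → Fin 2 → EuclideanSpace ℂ (Fin m)}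
    (h : SolvesEulerLagrange G)
    (hG : ∀ β k, AEStronglyMeasurable (fun x => G x β k) volume)
    (he : Integrable (gradSq G)) (hm : m ≤ 1) : ∀ᵐ x, gradSq G x = 0 := by
  have hR := stressRe_integrable hG he
  have hI := stressIm_integrable hG he
  -- The symmetries leave three unknowns: the real entries 00 and 01, and the imaginary entry 01.
  have hR10 : _root_.stressRe G 1 0 = _root_.stressRe G 0 1 := by
    ext x; simp [_root_.stressRe, mul_comm]
  have hR11 : _root_.stressRe G 1 1 = fun x => - _root_.stressRe G 0 0 x := by
    ext x
    have := sum_stressRe_self (G := G) x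
    simp only [Fin.sum_univ_two] at this
    push_cast at this
    linarith
  have hI00 : ∀ γ, _root_.stressIm G γ γ = 0 := by
    intro γ; ext x; simp [_root_.stressIm, mul_comm]
  have hI10 : _root_.stressIm G 1 0 = fun x => - _root_.stressIm G 0 1 x := by
    ext x
    simp only [_root_.stressIm, ← Finset.sum_neg_distrib]
    refine Finset.sum_congr rfl fun k _ => ?_
    simp; ring
  have key : ∀ (g g' : ℝ → ℝ), ContDiff ℝ (⊤ : ℕ∞) g → (∀ s, HasDerivAt g (g' s) s) →
      Continuous g' → (∀ s, |g s| ≤ 1) → (∀ s, |g' s| ≤ 1) → ∀ ξ : Rn 2,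
      ∫ x, _root_.stressRe G 0 0 x * g' (inner ℝ ξ x) = 0 ∧
      ∫ x, _root_.stressRe G 0 1 x * g' (inner ℝ ξ x) = 0 ∧
      ∫ x, _root_.stressIm G 0 1 x * g' (inner ℝ ξ x) = 0 := by
    intro g g' hg hg' hgc hb hb'
    have hne : ∀ ξ : Rn 2, ξ ≠ 0 → ∫ x, _root_.stressRe G 0 0 x * g' (inner ℝ ξ x) = 0 ∧
        ∫ x, _root_.stressRe G 0 1 x * g' (inner ℝ ξ x) = 0 ∧
        ∫ x, _root_.stressIm G 0 1 x * g' (inner ℝ ξ x) = 0 := by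
      intro ξ hξ
      have e1 := fun γ => sum_mul_integral_comp_inner_eq_zero (fun β => hR β γ)
        (fun φ hφ hc => h.stressRe hG he.locallyIntegrable γ hφ hc) hg hg' hgc hb hb' ξ
      have e2 := fun γ => sum_mul_integral_comp_inner_eq_zero (fun β => hI β γ)
        (fun φ hφ hc => h.stressIm hG he.locallyIntegrable γ hφ hc) hg hg' hgc hb hb' ξ
      have a0 := e1 0
      have a1 := e1 1
      have b0 := e2 0
      have b1 := e2 1
      simp only [Fin.sum_univ_two, hR10, hR11, hI00, hI10, neg_mul, integral_neg, Pi.zero_apply,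
        zero_mul, integral_zero, mul_zero, add_zero, zero_add] at a0 a1 b0 b1
      set A := ∫ x, _root_.stressRe G 0 0 x * g' (inner ℝ ξ x)
      set B := ∫ x, _root_.stressRe G 0 1 x * g' (inner ℝ ξ x)
      set C := ∫ x, _root_.stressIm G 0 1 x * g' (inner ℝ ξ x)
      -- The relations are ξ₀A + ξ₁B = 0 and ξ₀B − ξ₁A = 0, of determinant |ξ|², together with ξ₀C =
      -- ξ₁C = 0.
      have hpos : ξ 0 ^ 2 + ξ 1 ^ 2 ≠ 0 := by
        intro h0
        apply hξ
        ext i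
        have h1 : ξ 0 = 0 := by nlinarith [sq_nonneg (ξ 0), sq_nonneg (ξ 1)]
        have h2 : ξ 1 = 0 := by nlinarith [sq_nonneg (ξ 0), sq_nonneg (ξ 1)]
        fin_cases i
        · exact h1
        · exact h2
      refine ⟨?_, ?_, ?_⟩
      · refine (mul_eq_zero.1 (?_ : (ξ 0 ^ 2 + ξ 1 ^ 2) * A = 0)).resolve_left hpos
        linear_combination ξ 0 * a0 - ξ 1 * a1
      · refine (mul_eq_zero.1 (?_ : (ξ 0 ^ 2 + ξ 1 ^ 2) * B = 0)).resolve_left hpos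
        linear_combination ξ 1 * a0 + ξ 0 * a1
      · refine (mul_eq_zero.1 (?_ : (ξ 0 ^ 2 + ξ 1 ^ 2) * C = 0)).resolve_left hpos
        linear_combination ξ 0 * b1 - ξ 1 * b0
    have hext : ∀ T : Rn 2 → ℝ, Integrable T →
        (∀ ξ : Rn 2, ξ ≠ 0 → ∫ x, T x * g' (inner ℝ ξ x) = 0) →
        ∀ ξ : Rn 2, ∫ x, T x * g' (inner ℝ ξ x) = 0 := by
      intro T hT h0 ξ
      have hd : Dense {ξ : Rn 2 | ξ ≠ 0} := dense_compl_singleton 0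
      exact congrFun ((continuous_integral_mul_comp_inner hT hgc hb').ext_on hd
        continuous_const h0) ξ
    exact fun ξ => ⟨hext _ (hR 0 0) (fun ξ hξ => (hne ξ hξ).1) ξ,
      hext _ (hR 0 1) (fun ξ hξ => (hne ξ hξ).2.1) ξ,
      hext _ (hI 0 1) (fun ξ hξ => (hne ξ hξ).2.2) ξ⟩
  -- The derivatives of sin and −cos yield the cosine and sine transforms, at every frequency
  -- including 0.
  have kc := key Real.sin Real.cos Real.contDiff_sin Real.hasDerivAt_sin Real.continuous_cos
    Real.abs_sin_le_one Real.abs_cos_le_one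
  have ks := key (fun s => -Real.cos s) Real.sin Real.contDiff_cos.neg
    (fun s => by have := (Real.hasDerivAt_cos s).neg; rw [neg_neg] at this; exact this) Real.continuous_sin
    (fun s => by rw [abs_neg]; exact Real.abs_cos_le_one s) Real.abs_sin_le_one
  filter_upwards [ae_eq_zero_of_integral_cos_sin (hR 0 0) (fun ξ => (kc ξ).1) (fun ξ => (ks ξ).1),
    ae_eq_zero_of_integral_cos_sin (hR 0 1) (fun ξ => (kc ξ).2.1) (fun ξ => (ks ξ).2.1),
    ae_eq_zero_of_integral_cos_sin (hI 0 1) (fun ξ => (kc ξ).2.2) (fun ξ => (ks ξ).2.2)]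
    with x h1 h2 h3
  -- For m = 1 the sums over k have one term, so `h2` and `h3` make the product of the two partials
  -- zero, while `h1` equates their moduli.
  interval_cases m
  · simp [gradSq]
  · rw [stressRe_self] at h1
    simp only [_root_.stressRe, _root_.stressIm, gradSq, gradSqComp, Fin.sum_univ_two,
      Finset.univ_unique, Fin.default_eq_zero, Finset.sum_singleton, Pi.zero_apply] at h1 h2 h3 ⊢
    have h4 : G x 0 0 * conj (G x 1 0) = 0 := Complex.ext (by simpa using h2) (by simpa using h3)
    have h5 : ‖G x 0 0‖ * ‖G x 1 0‖ = 0 := by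
      rw [← RCLike.norm_conj (G x 1 0), ← norm_mul, h4, norm_zero]
    rcases mul_eq_zero.1 h5 with h6 | h6 <;> rw [h6] at h1 ⊢ <;> nlinarith

end Tensor

/-! ### The monotonicity formula -/

section Monotonicity

variable {n m : ℕ} {G : Rn n → Fin n → EuclideanSpace ℂ (Fin m)}

theorem cutoff_mul_integrable {e : Rn n → ℝ} (he : LocallyIntegrable e) {c : ℝ} (hc : 0 < c) :
    Integrable fun x => e x * cutoff (c * ‖x‖ ^ 2) :=
  he.integrable_smul_right_of_hasCompactSupport (cutoff_normSq_contDiff c).continuous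
    (cutoff_normSq_hasCompactSupport hc)

theorem continuous_deriv_cutoff_normSq (c : ℝ) :
    Continuous fun x : Rn n => deriv cutoff (c * ‖x‖ ^ 2) :=
  continuous_deriv_cutoff.comp (by fun_prop)

theorem deriv_cutoff_normSq_hasCompactSupport {c : ℝ} (hc : 0 < c) :
    HasCompactSupport (fun x : Rn n => deriv cutoff (c * ‖x‖ ^ 2)) := by
  refine HasCompactSupport.intro (isCompact_closedBall (0 : Rn n) (1 / c + 1)) fun x hx => ?_
  apply deriv_cutoff_of_gt
  have h1 : 1 / c + 1 < ‖x‖ := by simpa using hx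
  have h2 : 0 < 1 / c := by positivity
  have h3 : 1 / c < ‖x‖ ^ 2 := by nlinarith
  calc 1 = c * (1 / c) := by field_simp
    _ < _ := by gcongr

theorem deriv_cutoff_mul_integrable {e : Rn n → ℝ} (he : LocallyIntegrable e) {c : ℝ}
    (hc : 0 < c) : Integrable fun x => e x * (‖x‖ ^ 2 * deriv cutoff (c * ‖x‖ ^ 2)) :=
  he.integrable_smul_right_of_hasCompactSupport
    ((continuous_norm.pow 2).mul (continuous_deriv_cutoff_normSq c))
    (deriv_cutoff_normSq_hasCompactSupport hc).mul_left

theorem hasDerivAt_integral_mul_cutoff {e : Rn n → ℝ} (he : LocallyIntegrable e) {c : ℝ}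
    (hc : 0 < c) :
    HasDerivAt (fun c => ∫ x, e x * cutoff (c * ‖x‖ ^ 2))
      (∫ x, e x * (‖x‖ ^ 2 * deriv cutoff (c * ‖x‖ ^ 2))) c := by
  obtain ⟨C, hC0, hC⟩ := exists_deriv_cutoff_bound
  -- For b > c/2 the derivative of the cutoff lives where ‖x‖² ≤ 1/b < 2/c. There ‖x‖ ≤ 2/c + 1,
  -- because 2t ≤ t² + 1.
  set K := Metric.closedBall (0 : Rn n) (2 / c + 1) with hK
  refine (hasDerivAt_integral_of_dominated_loc_of_deriv_le (s := Ioi (c / 2))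
    (bound := K.indicator fun x => |e x| * ((2 / c) * C))
    (F' := fun c x => e x * (‖x‖ ^ 2 * deriv cutoff (c * ‖x‖ ^ 2))) (Ioi_mem_nhds (half_lt_self hc)) ?_
    (cutoff_mul_integrable he hc) (deriv_cutoff_mul_integrable he hc).1 ?_ ?_ ?_).2
  · filter_upwards [Ioi_mem_nhds hc] with b hb using (cutoff_mul_integrable he hb).1
  · refine Eventually.of_forall fun x b hb => ?_
    have hb' : c / 2 < b := hb
    have hb0 : 0 < b := by linarith
    rw [norm_mul, Real.norm_eq_abs, norm_mul, Real.norm_of_nonneg (sq_nonneg ‖x‖)]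
    by_cases h : 1 < b * ‖x‖ ^ 2
    · rw [deriv_cutoff_of_gt h]
      simp only [norm_zero, mul_zero]
      exact indicator_nonneg (fun x _ => by positivity) x
    · have h2 : ‖x‖ ^ 2 ≤ 2 / c := by
        rw [le_div_iff₀ hc]; nlinarith [sq_nonneg ‖x‖]
      have hx : x ∈ K := by
        rw [hK, mem_closedBall_zero_iff]
        nlinarith [norm_nonneg x, sq_nonneg (‖x‖ - 1)]
      rw [indicator_of_mem hx]
      gcongr
      exact hC _
  · refine (integrable_indicator_iff Metric.isClosed_closedBall.measurableSet).2 ?_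
    exact ((he.integrableOn_isCompact (isCompact_closedBall _ _)).abs).mul_const _
  · refine Eventually.of_forall fun x b _ => ?_
    have h1 : HasDerivAt (fun b : ℝ => b * ‖x‖ ^ 2) (‖x‖ ^ 2) b := by
      simpa using (hasDerivAt_id b).mul_const (‖x‖ ^ 2)
    have := ((cutoff_hasDerivAt (b * ‖x‖ ^ 2)).comp b h1).const_mul (e x)
    rwa [mul_comm (deriv cutoff _)] at this

theorem partialD_coord (β γ : Fin n) (x : Rn n) :
    partialD β (fun x : Rn n => x γ) x = if β = γ then 1 else 0 := by
  have : HasFDerivAt (fun x : Rn n => x γ) (EuclideanSpace.proj γ : Rn n →L[ℝ] ℝ) x :=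
    (EuclideanSpace.proj γ : Rn n →L[ℝ] ℝ).hasFDerivAt
  unfold partialD
  rw [this.fderiv]
  simp [eq_comm]

/-- For real x, expanding |∑_β x_β ∂_β z^k|² gives the double sum of real parts. The subtracted term
is the radial derivative, whose sign drives monotonicity. -/
theorem sum_stressRe_mul_coord (x : Rn n) :
    ∑ γ, ∑ β, stressRe G β γ x * (x β * x γ)
      = gradSq G x * ‖x‖ ^ 2 - 2 * ∑ k, ‖∑ β, (x β : ℂ) * G x β k‖ ^ 2 := by
  have hQ : ∀ k, ‖∑ β, (x β : ℂ) * G x β k‖ ^ 2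
      = ∑ γ, ∑ β, (G x β k * conj (G x γ k)).re * (x β * x γ) := by
    intro k
    rw [← Complex.normSq_eq_norm_sq, ← Complex.ofReal_re (Complex.normSq _), ← Complex.mul_conj,
      map_sum, Finset.mul_sum, Complex.re_sum]
    refine Finset.sum_congr rfl fun γ _ => ?_
    rw [Finset.sum_mul, Complex.re_sum]
    refine Finset.sum_congr rfl fun β _ => ?_
    rw [map_mul, Complex.conj_ofReal, ← Complex.re_mul_ofReal]
    push_cast
    congr 1; ring
  simp only [hQ, stressRe, sub_mul, Finset.sum_sub_distrib, ite_mul, zero_mul, Finset.sum_ite_eq',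
    Finset.mem_univ, if_true]
  congr 1
  · rw [← Finset.mul_sum, EuclideanSpace.norm_sq_eq]
    simp [sq]
  · rw [Finset.sum_comm, Finset.mul_sum]
    simp only [Finset.mul_sum, Finset.sum_mul]
    simp only [mul_assoc]
    rw [Finset.sum_comm]
    conv_rhs => rw [Finset.sum_comm]
    refine Finset.sum_congr rfl fun γ _ => ?_
    exact Finset.sum_comm

/-- The differential inequality behind the monotonicity formula. -/
theorem SolvesEulerLagrange.monotonicity_ineq (h : SolvesEulerLagrange G)
    (hG : ∀ β k, AEStronglyMeasurable (fun x => G x β k) volume)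
    (he : LocallyIntegrable (gradSq G)) {c : ℝ} (hc : 0 < c) :
    ((n : ℝ) - 2) * (∫ x, gradSq G x * cutoff (c * ‖x‖ ^ 2))
      + 2 * c * (∫ x, gradSq G x * (‖x‖ ^ 2 * deriv cutoff (c * ‖x‖ ^ 2))) ≤ 0 := by
  have hd : ∀ (γ : Fin n) (x : Rn n), DifferentiableAt ℝ (fun x : Rn n => x γ) x := fun γ x =>
    (EuclideanSpace.proj γ : Rn n →L[ℝ] ℝ).differentiableAt
  have hφ : ∀ γ : Fin n, ContDiff ℝ (⊤ : ℕ∞) (fun x : Rn n => x γ * cutoff (c * ‖x‖ ^ 2)) :=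
    fun γ => (EuclideanSpace.proj γ : Rn n →L[ℝ] ℝ).contDiff.mul (cutoff_normSq_contDiff c)
  have hφc : ∀ γ : Fin n, HasCompactSupport (fun x : Rn n => x γ * cutoff (c * ‖x‖ ^ 2)) :=
    fun γ => (cutoff_normSq_hasCompactSupport hc).mul_left
  have hRl : ∀ β γ, LocallyIntegrable (_root_.stressRe G β γ) := by
    intro β γ
    refine LocallyIntegrable.sub ?_ ?_
    · split_ifs
      · exact he
      · exact locallyIntegrable_zero
    · refine LocallyIntegrable.smul (E := ℝ) ?_ (2 : ℝ)
      refine locallyIntegrable_finsetSum _ fun k _ => ?_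
      refine he.mono (Complex.continuous_re.comp_aestronglyMeasurable
        (mul_conj_aestronglyMeasurable hG β γ k)) (Eventually.of_forall fun x => ?_)
      exact (Complex.abs_re_le_norm _).trans
        ((norm_mul_conj_le_gradSq β γ k x).trans (le_abs_self _))
  have hint : ∀ γ, Integrable fun x => ∑ β, _root_.stressRe G β γ x *
      partialD β (fun x : Rn n => x γ * cutoff (c * ‖x‖ ^ 2)) x := fun γ =>
    integrable_finsetSum _ fun β _ =>
      (hRl β γ).integrable_smul_right_of_hasCompactSupport (continuous_partialD (hφ γ) β)
        (hasCompactSupport_partialD (hφc γ) β)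
  have hint' := integrable_finsetSum Finset.univ fun γ _ => hint γ
  have h0 : ∫ x, ∑ γ, ∑ β, _root_.stressRe G β γ x *
      partialD β (fun x : Rn n => x γ * cutoff (c * ‖x‖ ^ 2)) x = 0 := by
    rw [integral_finsetSum _ fun γ _ => hint γ]
    exact Finset.sum_eq_zero fun γ _ => h.stressRe hG he γ (hφ γ) (hφc γ)
  have hpt : ∀ x, ∑ γ, ∑ β, _root_.stressRe G β γ x *
      partialD β (fun x : Rn n => x γ * cutoff (c * ‖x‖ ^ 2)) x
      = (n - 2) * (gradSq G x * cutoff (c * ‖x‖ ^ 2))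
        + 2 * c * deriv cutoff (c * ‖x‖ ^ 2) *
          (gradSq G x * ‖x‖ ^ 2 - 2 * ∑ k, ‖∑ β, (x β : ℂ) * G x β k‖ ^ 2) := by
    intro x
    have : ∀ γ β, _root_.stressRe G β γ x *
        partialD β (fun x : Rn n => x γ * cutoff (c * ‖x‖ ^ 2)) x
        = (if β = γ then _root_.stressRe G β γ x * cutoff (c * ‖x‖ ^ 2) else 0)
          + 2 * c * deriv cutoff (c * ‖x‖ ^ 2) * (_root_.stressRe G β γ x * (x β * x γ)) := by
      intro γ β
      rw [partialD_mul_cutoff c x (hd γ x) β, partialD_coord]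
      split_ifs <;> ring
    simp only [this, Finset.sum_add_distrib, ← Finset.mul_sum, sum_stressRe_mul_coord,
      Finset.sum_ite_eq', Finset.mem_univ, if_true, ← Finset.sum_mul, sum_stressRe_self]
    ring
  simp only [hpt] at h0 hint'
  have i1 := (cutoff_mul_integrable he hc).const_mul ((n : ℝ) - 2)
  have i2 := (deriv_cutoff_mul_integrable he hc).const_mul (2 * c)
  rw [← h0, ← integral_const_mul, ← integral_const_mul, ← integral_add i1 i2]
  refine integral_mono (i1.add i2) hint' fun x => ?_
  -- The two integrands differ by −4c times the derivative of the cutoff times this sum, which is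
  -- nonnegative because the cutoff is nonincreasing.
  have hQ : 0 ≤ ∑ k, ‖∑ β, (x β : ℂ) * G x β k‖ ^ 2 := Finset.sum_nonneg fun _ _ => sq_nonneg _
  have h1 : 0 ≤ c * (-deriv cutoff (c * ‖x‖ ^ 2)) * ∑ k, ‖∑ β, (x β : ℂ) * G x β k‖ ^ 2 :=
    mul_nonneg (mul_nonneg hc.le (neg_nonneg.2 (deriv_cutoff_nonpos _))) hQ
  simp only []
  linarith

/-- Solutions of the Euler–Lagrange system whose rescaled energy tends to zero vanish. -/
theorem SolvesEulerLagrange.gradSq_eq_zero_of_tendsto (h : SolvesEulerLagrange G)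
    (hG : ∀ β k, AEStronglyMeasurable (fun x => G x β k) volume)
    (he : LocallyIntegrable (gradSq G))
    (hlim : Tendsto (fun r : ℝ => 1 / r ^ ((n : ℤ) - 2) * ∫ x in Metric.ball (0 : Rn n) r,
      gradSq G x) atTop (𝓝 0)) : ∀ᵐ x, gradSq G x = 0 := by
  set J : ℝ → ℝ := fun c => ∫ x, gradSq G x * cutoff (c * ‖x‖ ^ 2) with hJ
  -- With c = 1/r² the power c^p is r^(2-n), the scaling factor of the hypothesis.
  set p : ℝ := ((n : ℝ) - 2) / 2 with hp
  have hJ0 : ∀ c, 0 ≤ J c := fun c =>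
    integral_nonneg fun x => mul_nonneg (gradSq_nonneg x) (cutoff_nonneg _)
  have hder : ∀ c, 0 < c → HasDerivAt (fun c => c ^ p * J c)
      (p * c ^ (p - 1) * J c
        + c ^ p * ∫ x, gradSq G x * (‖x‖ ^ 2 * deriv cutoff (c * ‖x‖ ^ 2))) c := fun c hc =>
    (Real.hasDerivAt_rpow_const (Or.inl hc.ne')).mul (hasDerivAt_integral_mul_cutoff he hc)
  have hanti : AntitoneOn (fun c => c ^ p * J c) (Ioi 0) := by
    refine antitoneOn_of_deriv_nonpos (convex_Ioi 0)
      (fun c hc => (hder c hc).continuousAt.continuousWithinAt)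
      (fun c hc => (hder c (interior_subset hc)).differentiableAt.differentiableWithinAt)
      fun c hc => ?_
    have hc' : 0 < c := interior_subset hc
    rw [(hder c hc').deriv]
    have h1 := h.monotonicity_ineq hG he hc'
    have h2 : c ^ p = c ^ (p - 1) * c := by
      rw [← Real.rpow_add_one hc'.ne']; congr 1; ring
    have h3 : 0 < c ^ (p - 1) := Real.rpow_pos_of_pos hc' _
    rw [h2]
    -- The derivative is c^(p-1)/2 times the left side of `monotonicity_ineq`.
    have h4 : p * c ^ (p - 1) * J c + c ^ (p - 1) * c * ∫ x, gradSq G x *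
        (‖x‖ ^ 2 * deriv cutoff (c * ‖x‖ ^ 2)) = c ^ (p - 1) / 2 * (((n : ℝ) - 2) * J c
        + 2 * c * ∫ x, gradSq G x * (‖x‖ ^ 2 * deriv cutoff (c * ‖x‖ ^ 2))) := by
      rw [hp]; ring
    rw [h4]
    exact mul_nonpos_of_nonneg_of_nonpos (by positivity) h1
  have hle : ∀ r : ℝ, 0 < r → (1 / r ^ 2) ^ p * J (1 / r ^ 2)
      ≤ 1 / r ^ ((n : ℤ) - 2) * ∫ x in Metric.ball (0 : Rn n) r, gradSq G x := by
    intro r hr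
    have h1 : (1 / r ^ 2) ^ p = 1 / r ^ ((n : ℤ) - 2) := by
      rw [Real.div_rpow zero_le_one (by positivity), Real.one_rpow, ← Real.rpow_natCast,
        ← Real.rpow_mul hr.le, ← Real.rpow_intCast]
      congr 2
      rw [hp]; push_cast; ring
    rw [h1]
    refine mul_le_mul_of_nonneg_left ?_ (by positivity)
    rw [← integral_indicator Metric.isOpen_ball.measurableSet]
    refine integral_mono (cutoff_mul_integrable he (by positivity))
      ((integrable_indicator_iff Metric.isOpen_ball.measurableSet).2
        ((he.integrableOn_isCompact (isCompact_closedBall 0 r)).mono_set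
          Metric.ball_subset_closedBall)) fun x => ?_
    by_cases hx : x ∈ Metric.ball (0 : Rn n) r
    · simp only [indicator_of_mem hx]
      exact mul_le_of_le_one_right (gradSq_nonneg x) (cutoff_le_one _)
    · simp only [indicator_of_notMem hx]
      rw [cutoff_of_ge, mul_zero]
      have : r ≤ ‖x‖ := by simpa using hx
      rw [one_div, ← div_eq_inv_mul, one_le_div (by positivity)]
      gcongr
  have hJz : ∀ c, 0 < c → J c = 0 := by
    intro c hc
    have h1 : c ^ p * J c ≤ 0 := by
      refine ge_of_tendsto hlim ?_
      -- If r ≥ 1 and r ≥ 1/c, then 1/r² ≤ c, so antitonicity bounds the value at c by the rescaled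
      -- energy on B(0, r).
      filter_upwards [eventually_gt_atTop 0, eventually_ge_atTop (1 / c), eventually_ge_atTop 1]
        with r hr hrc hr1
      refine le_trans (hanti (a := 1 / r ^ 2) (by simp; positivity) hc ?_) (hle r hr)
      rw [div_le_iff₀ (by positivity)]
      rw [div_le_iff₀ hc] at hrc
      nlinarith
    have h2 := Real.rpow_pos_of_pos hc p
    have h3 := hJ0 c
    nlinarith
  -- Countably many cutoffs suffice: at a given x the k-th equals 1 once k > 2‖x‖².
  have hk : ∀ k : ℕ, ∀ᵐ x, gradSq G x * cutoff (1 / ((k : ℝ) + 1) * ‖x‖ ^ 2) = 0 := by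
    intro k
    have hc : 0 < 1 / ((k : ℝ) + 1) := by positivity
    exact (integral_eq_zero_iff_of_nonneg
      (fun x => mul_nonneg (gradSq_nonneg x) (cutoff_nonneg _)) (cutoff_mul_integrable he hc)).1
      (hJz _ hc)
  filter_upwards [ae_all_iff.2 hk] with x hx
  obtain ⟨k, hk⟩ := exists_nat_gt (2 * ‖x‖ ^ 2)
  have := hx k
  rwa [cutoff_of_le, mul_one] at this
  rw [one_div, ← div_eq_inv_mul, div_le_iff₀ (by positivity)]
  linarith

end Monotonicity

/-! ### Second moments of the sphere -/

section Weight

/-- The Gram form of the surface measure of the unit sphere is nondegenerate. -/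
theorem exists_integral_sphere_inner_mul_inner {n : ℕ} (β : Fin n) :
    ∃ v : Rn n, ∀ y : Rn n, ∫ ω : Metric.sphere (0 : Rn n) 1,
      inner ℝ v (ω : Rn n) * inner ℝ y (ω : Rn n) ∂((volume : Measure (Rn n)).toSphere) = y β := by
  have hi : ∀ v y : Rn n, Integrable (fun ω : Metric.sphere (0 : Rn n) 1 =>
      inner ℝ v (ω : Rn n) * inner ℝ y (ω : Rn n)) ((volume : Measure (Rn n)).toSphere) := by
    intro v y
    refine Continuous.integrable_of_hasCompactSupport (by fun_prop) ?_
    exact HasCompactSupport.of_compactSpace _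
  -- The second-moment form is positive definite, so in finite dimension it represents the
  -- coordinate functional, and no moment has to be computed.
  let L : Rn n →ₗ[ℝ] Module.Dual ℝ (Rn n) := LinearMap.mk₂ ℝ
    (fun v y => ∫ ω : Metric.sphere (0 : Rn n) 1,
      inner ℝ v (ω : Rn n) * inner ℝ y (ω : Rn n) ∂((volume : Measure (Rn n)).toSphere))
    (fun v w y => by
      rw [← integral_add (hi v y) (hi w y)]; simp only [inner_add_left, add_mul])
    (fun c v y => by
      rw [smul_eq_mul, ← integral_const_mul]; simp only [real_inner_smul_left, mul_assoc])
    (fun v y w => by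
      rw [← integral_add (hi v y) (hi v w)]; simp only [inner_add_left, mul_add])
    (fun c v y => by
      rw [smul_eq_mul, ← integral_const_mul]; simp only [real_inner_smul_left, mul_left_comm])
  have hL : Function.Injective L := by
    rw [injective_iff_map_eq_zero]
    intro v hv
    by_contra hne
    have h0 : ∫ ω : Metric.sphere (0 : Rn n) 1,
      inner ℝ v (ω : Rn n) * inner ℝ v (ω : Rn n) ∂((volume : Measure (Rn n)).toSphere) = 0 :=
      LinearMap.congr_fun hv v
    have hpos : 0 < ‖v‖ := norm_pos_iff.2 hne
    let ω₀ : Metric.sphere (0 : Rn n) 1 := ⟨‖v‖⁻¹ • v, by simp [norm_smul, hpos.ne']⟩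
    have := Continuous.integral_pos_of_hasCompactSupport_nonneg_nonzero
      (μ := (volume : Measure (Rn n)).toSphere)
      (f := fun ω : Metric.sphere (0 : Rn n) 1 => inner ℝ v (ω : Rn n) * inner ℝ v (ω : Rn n))
      (x := ω₀) (by fun_prop) (HasCompactSupport.of_compactSpace _)
      (fun ω => mul_self_nonneg _) (by simp [ω₀, real_inner_smul_right, hne])
    exact this.ne' h0
  have hs := (LinearMap.injective_iff_surjective_of_finrank_eq_finrank
    (Subspace.dual_finrank_eq (K := ℝ) (V := Rn n)).symm).1 hL
  obtain ⟨v, hv⟩ := hs (EuclideanSpace.proj β : Rn n →L[ℝ] ℝ).toLinearMap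
  exact ⟨v, fun y => LinearMap.congr_fun hv y⟩

end Weight

/-! ### Weak derivatives by duality -/

/-- A linear functional dominated by the norm of a linear map into a Hilbert space is represented
by a vector. -/
theorem exists_inner_eq_of_abs_le {D H : Type*} [AddCommGroup D] [Module ℝ D]
    [NormedAddCommGroup H] [InnerProductSpace ℝ H] [CompleteSpace H] (ι : D →ₗ[ℝ] H)
    (T : D →ₗ[ℝ] ℝ) (C : ℝ) (h : ∀ φ, |T φ| ≤ C * ‖ι φ‖) :
    ∃ g : H, ∀ φ, T φ = inner ℝ g (ι φ) := by
  -- The bound kills `T` on the kernel of `ι`, so `T` descends to the range of `ι`; Hahn–Banach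
  -- extends it and Riesz represents it.
  have hker : LinearMap.ker ι ≤ LinearMap.ker T := by
    intro φ hφ
    have := h φ
    rw [LinearMap.mem_ker.1 hφ, norm_zero, mul_zero] at this
    exact abs_nonpos_iff.1 this
  let f : LinearMap.range ι →ₗ[ℝ] ℝ :=
    ((LinearMap.ker ι).liftQ T hker) ∘ₗ ι.quotKerEquivRange.symm.toLinearMap
  have hf : ∀ φ, f ⟨ι φ, LinearMap.mem_range_self ι φ⟩ = T φ := by
    intro φ
    have : ι.quotKerEquivRange.symm ⟨ι φ, LinearMap.mem_range_self ι φ⟩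
        = (LinearMap.ker ι).mkQ φ := by
      rw [LinearEquiv.symm_apply_eq]; rfl
    simp only [f, LinearMap.comp_apply, LinearEquiv.coe_coe, this]
    rfl
  have hbound : ∀ y, ‖f y‖ ≤ C * ‖y‖ := by
    rintro ⟨_, φ, rfl⟩
    rw [hf]; exact h φ
  obtain ⟨F, hF, -⟩ := exists_extension_norm_eq (𝕜 := ℝ) _ (f.mkContinuous C hbound)
  refine ⟨(InnerProductSpace.toDual ℝ H).symm F, fun φ => ?_⟩
  rw [InnerProductSpace.toDual_symm_apply]
  have := hF ⟨ι φ, LinearMap.mem_range_self ι φ⟩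
  rw [this]
  exact (hf φ).symm

/-- The smooth functions with compact support in `V`. -/
def testSubmodule {n : ℕ} (V : Set (Rn n)) : Submodule ℝ (Rn n → ℝ) where
  carrier := {φ | ContDiff ℝ (⊤ : ℕ∞) φ ∧ HasCompactSupport φ ∧ tsupport φ ⊆ V}
  zero_mem' := ⟨contDiff_const, HasCompactSupport.zero, by simp [tsupport]⟩
  add_mem' := fun ha hb => ⟨ha.1.add hb.1, ha.2.1.add hb.2.1,
    (tsupport_add _ _).trans (union_subset ha.2.2 hb.2.2)⟩
  smul_mem' := fun c _ ha => ⟨contDiff_const.smul ha.1, ha.2.1.smul_left,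
    (tsupport_smul_subset_right (fun _ => c) _).trans ha.2.2⟩

theorem partialD_add {n : ℕ} {φ ψ : Rn n → ℝ} (hφ : ContDiff ℝ (⊤ : ℕ∞) φ)
    (hψ : ContDiff ℝ (⊤ : ℕ∞) ψ) (β : Fin n) :
    partialD β (φ + ψ) = partialD β φ + partialD β ψ := by
  ext x
  unfold partialD
  rw [fderiv_add (hφ.differentiable (by simp) x) (hψ.differentiable (by simp) x)]
  rfl

theorem partialD_smul {n : ℕ} {φ : Rn n → ℝ} (hφ : ContDiff ℝ (⊤ : ℕ∞) φ) (c : ℝ) (β : Fin n) :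
    partialD β (c • φ) = c • partialD β φ := by
  ext x
  unfold partialD
  rw [fderiv_const_smul (hφ.differentiable (by simp) x)]
  rfl

/-- A locally integrable function whose distributional derivative is bounded in `L²` has a weak
derivative in `L²`. -/
theorem exists_weak_partial_of_bound {n : ℕ} {V : Set (Rn n)} {u : Rn n → ℝ}
    (hu : LocallyIntegrable u) (β : Fin n) {A B : ℝ}
    (h : ∀ φ : Rn n → ℝ, ContDiff ℝ (⊤ : ℕ∞) φ → HasCompactSupport φ → tsupport φ ⊆ V →
      2 * |∫ x, partialD β φ x * u x| ≤ A * (∫ x, φ x ^ 2) + B) :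
    ∃ g : Rn n → ℝ, MemLp g 2 ∧
      ∀ φ : Rn n → ℝ, ContDiff ℝ (⊤ : ℕ∞) φ → HasCompactSupport φ → tsupport φ ⊆ V →
        ∫ x, partialD β φ x * u x = - ∫ x, φ x * g x := by
  have hint : ∀ φ : testSubmodule V, Integrable fun x => partialD β φ.1 x * u x := fun φ =>
    hu.integrable_smul_left_of_hasCompactSupport (continuous_partialD φ.2.1 β)
      (hasCompactSupport_partialD φ.2.2.1 β)
  have hmem : ∀ φ : testSubmodule V, MemLp φ.1 2 volume := fun φ =>
    φ.2.1.continuous.memLp_of_hasCompactSupport φ.2.2.1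
  let ι : testSubmodule V →ₗ[ℝ] Lp ℝ 2 (volume : Measure (Rn n)) :=
    { toFun := fun φ => (hmem φ).toLp
      map_add' := fun φ ψ => MemLp.toLp_add (hmem φ) (hmem ψ)
      map_smul' := fun c φ => MemLp.toLp_const_smul c (hmem φ) }
  let T : testSubmodule V →ₗ[ℝ] ℝ :=
    { toFun := fun φ => ∫ x, partialD β φ.1 x * u x
      map_add' := fun φ ψ => by
        rw [← integral_add (hint φ) (hint ψ), Submodule.coe_add, partialD_add φ.2.1 ψ.2.1]
        simp only [Pi.add_apply, add_mul]
      map_smul' := fun c φ => by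
        rw [RingHom.id_apply, smul_eq_mul, ← integral_const_mul, Submodule.coe_smul,
          partialD_smul φ.2.1]
        simp only [Pi.smul_apply, smul_eq_mul, mul_assoc] }
  have hnorm : ∀ φ : testSubmodule V, ∫ x, φ.1 x ^ 2 = ‖ι φ‖ ^ 2 := by
    intro φ
    rw [← real_inner_self_eq_norm_sq, L2.inner_def]
    refine integral_congr_ae ?_
    filter_upwards [(hmem φ).coeFn_toLp] with x hx
    simp only [ι, LinearMap.coe_mk, AddHom.coe_mk, hx]
    simp [sq]
  -- The hypothesis is not homogeneous in φ, so it is applied to sφ and s is then optimised.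
  have hT : ∀ (φ : testSubmodule V) (s : ℝ), 0 < s →
      2 * (s * |T φ|) ≤ A * (s ^ 2 * ‖ι φ‖ ^ 2) + B := by
    intro φ s hs
    have := h (s • φ).1 (s • φ).2.1 (s • φ).2.2.1 (s • φ).2.2.2
    rw [hnorm, map_smul, norm_smul, mul_pow, Real.norm_eq_abs, sq_abs] at this
    have h2 : ∫ x, partialD β (s • φ).1 x * u x = s * T φ := map_smul T s φ
    rwa [h2, abs_mul, abs_of_pos hs] at this
  have hbound : ∀ φ, |T φ| ≤ ((A + B) / 2) * ‖ι φ‖ := by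
    intro φ
    rcases (norm_nonneg (ι φ)).eq_or_lt with h0 | h0
    · rw [← h0, mul_zero]
      by_contra! hc
      -- If φ has norm 0, this s would give 2(|B| + 1) ≤ B.
      have := hT φ ((|B| + 1) / |T φ|) (by positivity)
      rw [← h0, div_mul_cancel₀ _ hc.ne'] at this
      have hB := le_abs_self B
      have hB' := abs_nonneg B
      simp only [ne_eq, OfNat.ofNat_ne_zero, not_false_eq_true, zero_pow, mul_zero] at this
      linarith
    · have := hT φ (1 / ‖ι φ‖) (by positivity)
      have h1 : (1 / ‖ι φ‖) ^ 2 * ‖ι φ‖ ^ 2 = 1 := by field_simp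
      rw [h1, one_div, ← div_eq_inv_mul] at this
      have h2 : |T φ| / ‖ι φ‖ ≤ (A + B) / 2 := by linarith
      rwa [div_le_iff₀ h0] at h2
  obtain ⟨g, hg⟩ := exists_inner_eq_of_abs_le ι T _ hbound
  refine ⟨fun x => - g x, (Lp.memLp g).neg, fun φ h1 h2 h3 => ?_⟩
  have := hg ⟨φ, h1, h2, h3⟩
  change ∫ x, partialD β φ x * u x = _ at this
  rw [this, L2.inner_def, ← integral_neg]
  refine integral_congr_ae ?_
  filter_upwards [(hmem ⟨φ, h1, h2, h3⟩).coeFn_toLp] with x hx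
  simp only [ι, LinearMap.coe_mk, AddHom.coe_mk, hx]
  simp

/-! ### Averaged difference quotients -/

section KorevaarSchoen

variable {n : ℕ}

/-- The surface measure of the unit sphere. -/
noncomputable abbrev sphereMeasure (n : ℕ) : Measure (Metric.sphere (0 : Rn n) 1) :=
  (volume : Measure (Rn n)).toSphere

/-- For each fixed ω this is a translation. It is the change of variables that moves the shift from
u to the test function. -/
theorem measurePreserving_sphere_shear (ε : ℝ) :
    MeasurePreserving (fun z : Metric.sphere (0 : Rn n) 1 × Rn n => (z.1, z.2 + ε • (z.1 : Rn n)))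
      ((sphereMeasure n).prod volume) ((sphereMeasure n).prod volume) := by
  refine (MeasurePreserving.id (sphereMeasure n)).skew_product
    (g := fun ω p => p + ε • (ω : Rn n)) ?_ ?_
  · fun_prop
  · exact Eventually.of_forall fun ω => (measurePreserving_add_right volume (ε • (ω : Rn n))).map_eq

theorem norm_sphere (ω : Metric.sphere (0 : Rn n) 1) : ‖(ω : Rn n)‖ = 1 := by
  simp

theorem abs_inner_sphere_le (v : Rn n) (ω : Metric.sphere (0 : Rn n) 1) :
    |inner ℝ v (ω : Rn n)| ≤ ‖v‖ := by
  simpa [norm_sphere] using abs_real_inner_le_norm v (ω : Rn n)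

/-- A common majorant: the sphere has finite measure and u is integrable on balls. -/
theorem integrable_sphere_prod_indicator {u : Rn n → ℝ} (hu : LocallyIntegrable u) (C R : ℝ) :
    Integrable (fun z : Metric.sphere (0 : Rn n) 1 × Rn n =>
      C * (Metric.closedBall (0 : Rn n) R).indicator (fun p => |u p|) z.2)
      ((sphereMeasure n).prod volume) := by
  have h : Integrable ((Metric.closedBall (0 : Rn n) R).indicator fun p => |u p|) :=
    (integrable_indicator_iff Metric.isClosed_closedBall.measurableSet).2
      (hu.integrableOn_isCompact (isCompact_closedBall _ _)).abs
  exact (integrable_const C).mul_prod (f := fun _ => C) h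

/-- Discrete integration by parts for averaged difference quotients. -/
theorem integral_sphere_difference_quotient {u : Rn n → ℝ} (hum : Measurable u)
    (hu : LocallyIntegrable u) {φ : Rn n → ℝ} (hφ : Continuous φ) (hc : HasCompactSupport φ)
    (v : Rn n) (ε : ℝ) :
    ∫ z : Metric.sphere (0 : Rn n) 1 × Rn n,
        inner ℝ v (z.1 : Rn n) * (φ z.2 * ((u (z.2 + ε • (z.1 : Rn n)) - u z.2) / ε))
      ∂((sphereMeasure n).prod volume) =
    ∫ z : Metric.sphere (0 : Rn n) 1 × Rn n,
        inner ℝ v (z.1 : Rn n) * (u z.2 * ((φ (z.2 - ε • (z.1 : Rn n)) - φ z.2) / ε))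
      ∂((sphereMeasure n).prod volume) := by
  obtain ⟨M, hM⟩ := hc.exists_bound_of_continuous hφ
  have hM0 : 0 ≤ M := (norm_nonneg _).trans (hM 0)
  obtain ⟨R, hR⟩ := hc.isCompact.isBounded.subset_closedBall (0 : Rn n)
  have hφ0 : ∀ x : Rn n, R < ‖x‖ → φ x = 0 := by
    intro x hx
    by_contra h
    have := hR (subset_tsupport φ h)
    rw [mem_closedBall_zero_iff] at this
    linarith
  have hi : ∀ δ : ℝ, Integrable (fun z : Metric.sphere (0 : Rn n) 1 × Rn n =>
      inner ℝ v (z.1 : Rn n) * (φ (z.2 - δ • (z.1 : Rn n)) * u z.2))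
      ((sphereMeasure n).prod volume) := by
    intro δ
    refine (integrable_sphere_prod_indicator hu (‖v‖ * M) (R + |δ|)).mono' ?_ ?_
    · exact Measurable.aestronglyMeasurable (by fun_prop)
    · refine Eventually.of_forall fun z => ?_
      rw [norm_mul, norm_mul]
      by_cases hz : z.2 ∈ Metric.closedBall (0 : Rn n) (R + |δ|)
      · rw [indicator_of_mem hz, mul_assoc]
        gcongr
        · exact abs_inner_sphere_le v z.1
        · exact hM _
        · exact le_rfl
      · rw [indicator_of_notMem hz, hφ0]
        · simp
        · have h1 : R + |δ| < ‖z.2‖ := by simpa using hz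
          have h2 := norm_sub_norm_le z.2 (δ • (z.1 : Rn n))
          rw [norm_smul, norm_sphere, mul_one, Real.norm_eq_abs] at h2
          linarith
  have hS := measurePreserving_sphere_shear (n := n) ε
  have hcomp : ∀ z : Metric.sphere (0 : Rn n) 1 × Rn n,
      inner ℝ v (z.1 : Rn n) * (φ z.2 * u (z.2 + ε • (z.1 : Rn n))) =
      (fun z : Metric.sphere (0 : Rn n) 1 × Rn n =>
        inner ℝ v (z.1 : Rn n) * (φ (z.2 - ε • (z.1 : Rn n)) * u z.2))
        (z.1, z.2 + ε • (z.1 : Rn n)) := by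
    intro z; simp
  have hi1 : Integrable (fun z : Metric.sphere (0 : Rn n) 1 × Rn n =>
      inner ℝ v (z.1 : Rn n) * (φ z.2 * u (z.2 + ε • (z.1 : Rn n))))
      ((sphereMeasure n).prod volume) := by
    simp only [hcomp]
    exact hS.integrable_comp_of_integrable (hi ε)
  have hi0 : Integrable (fun z : Metric.sphere (0 : Rn n) 1 × Rn n =>
      inner ℝ v (z.1 : Rn n) * (φ z.2 * u z.2)) ((sphereMeasure n).prod volume) := by
    simpa using hi 0
  have he : ∫ z : Metric.sphere (0 : Rn n) 1 × Rn n,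
      inner ℝ v (z.1 : Rn n) * (φ z.2 * u (z.2 + ε • (z.1 : Rn n)))
        ∂((sphereMeasure n).prod volume) =
      ∫ z : Metric.sphere (0 : Rn n) 1 × Rn n,
      inner ℝ v (z.1 : Rn n) * (φ (z.2 - ε • (z.1 : Rn n)) * u z.2)
        ∂((sphereMeasure n).prod volume) := by
    simp only [hcomp]
    have h1 := (hi ε).1
    rw [← hS.map_eq] at h1
    have := integral_map hS.measurable.aemeasurable h1
    rw [hS.map_eq] at this
    exact this.symm
  have e1 : (fun z : Metric.sphere (0 : Rn n) 1 × Rn n =>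
      inner ℝ v (z.1 : Rn n) * (φ z.2 * ((u (z.2 + ε • (z.1 : Rn n)) - u z.2) / ε))) =
      fun z => (inner ℝ v (z.1 : Rn n) * (φ z.2 * u (z.2 + ε • (z.1 : Rn n)))
        - inner ℝ v (z.1 : Rn n) * (φ z.2 * u z.2)) / ε := by
    ext z; ring
  have e2 : (fun z : Metric.sphere (0 : Rn n) 1 × Rn n =>
      inner ℝ v (z.1 : Rn n) * (u z.2 * ((φ (z.2 - ε • (z.1 : Rn n)) - φ z.2) / ε))) =
      fun z => (inner ℝ v (z.1 : Rn n) * (φ (z.2 - ε • (z.1 : Rn n)) * u z.2)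
        - inner ℝ v (z.1 : Rn n) * (φ z.2 * u z.2)) / ε := by
    ext z; ring
  rw [e1, e2, integral_div, integral_div, integral_sub hi1 hi0, integral_sub (hi ε) hi0, he]

/-- Averaged difference quotients of a test function converge to a partial derivative. -/
theorem tendsto_integral_sphere_difference_quotient {u : Rn n → ℝ} (hum : Measurable u)
    (hu : LocallyIntegrable u) {φ : Rn n → ℝ} (hφ : ContDiff ℝ (⊤ : ℕ∞) φ)
    (hc : HasCompactSupport φ) {v : Rn n} {β : Fin n}
    (hv : ∀ y : Rn n, ∫ ω : Metric.sphere (0 : Rn n) 1,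
      inner ℝ v (ω : Rn n) * inner ℝ y (ω : Rn n) ∂(sphereMeasure n) = y β) :
    Tendsto (fun ε : ℝ => ∫ z : Metric.sphere (0 : Rn n) 1 × Rn n,
        inner ℝ v (z.1 : Rn n) * (u z.2 * ((φ (z.2 - ε • (z.1 : Rn n)) - φ z.2) / ε))
      ∂((sphereMeasure n).prod volume)) (𝓝[>] 0) (𝓝 (-∫ x, partialD β φ x * u x)) := by
  obtain ⟨L, hL⟩ := hφ.lipschitzWith_of_hasCompactSupport hc (by simp)
  obtain ⟨R, hR⟩ := hc.isCompact.isBounded.subset_closedBall (0 : Rn n)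
  have hφ0 : ∀ x : Rn n, R < ‖x‖ → φ x = 0 := by
    intro x hx
    by_contra h
    have := hR (subset_tsupport φ h)
    rw [mem_closedBall_zero_iff] at this
    linarith
  have hlim : Tendsto (fun ε : ℝ => ∫ z : Metric.sphere (0 : Rn n) 1 × Rn n,
        inner ℝ v (z.1 : Rn n) * (u z.2 * ((φ (z.2 - ε • (z.1 : Rn n)) - φ z.2) / ε))
      ∂((sphereMeasure n).prod volume)) (𝓝[>] 0)
      (𝓝 (∫ z : Metric.sphere (0 : Rn n) 1 × Rn n,
        inner ℝ v (z.1 : Rn n) * (u z.2 * (fderiv ℝ φ z.2 (-(z.1 : Rn n))))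
      ∂((sphereMeasure n).prod volume))) := by
    refine tendsto_integral_filter_of_dominated_convergence _ ?_ ?_
      (integrable_sphere_prod_indicator hu (‖v‖ * L) (R + 1)) ?_
    · have := hφ.continuous
      exact Eventually.of_forall fun ε => Measurable.aestronglyMeasurable (by fun_prop)
    -- With ε ≤ 1 the shifted test function vanishes outside radius R + 1, so one majorant serves
    -- all ε.
    · filter_upwards [Ioc_mem_nhdsGT (zero_lt_one : (0 : ℝ) < 1)] with ε hε
      refine Eventually.of_forall fun z => ?_
      rw [norm_mul, norm_mul, mul_comm ‖u z.2‖]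
      by_cases hz : z.2 ∈ Metric.closedBall (0 : Rn n) (R + 1)
      · rw [indicator_of_mem hz, mul_assoc]
        gcongr
        · exact abs_inner_sphere_le v z.1
        · rw [norm_div, Real.norm_of_nonneg hε.1.le, div_le_iff₀ hε.1]
          have := hL.norm_sub_le (z.2 - ε • (z.1 : Rn n)) z.2
          simpa [norm_smul, norm_sphere, abs_of_pos hε.1] using this
        · exact le_rfl
      · have h1 : R + 1 < ‖z.2‖ := by simpa using hz
        rw [indicator_of_notMem hz, hφ0 z.2 (by linarith), hφ0]
        · simp
        · have h2 := norm_sub_norm_le z.2 (ε • (z.1 : Rn n))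
          rw [norm_smul, norm_sphere, mul_one, Real.norm_of_nonneg hε.1.le] at h2
          linarith [hε.2]
    · refine Eventually.of_forall fun z => Tendsto.const_mul _ (Tendsto.const_mul _ ?_)
      have h1 : HasDerivAt (fun t : ℝ => φ (z.2 + t • (-(z.1 : Rn n))))
          (fderiv ℝ φ z.2 (-(z.1 : Rn n))) 0 :=
        ((hφ.differentiable (by simp) z.2).hasFDerivAt.hasLineDerivAt _)
      have h2 := (hasDerivAt_iff_tendsto_slope_zero.1 h1).mono_left
        (nhdsWithin_mono (0 : ℝ) (fun x (hx : 0 < x) => hx.ne'))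
      refine h2.congr fun t => ?_
      simp only [zero_add, zero_smul, neg_zero, add_zero, smul_neg, smul_eq_mul, ← sub_eq_add_neg]
      rw [div_eq_inv_mul]
  have hgrad : ∀ (x : Rn n), ∃ y : Rn n, (∀ w, fderiv ℝ φ x w = inner ℝ y w) := fun x =>
    ⟨(InnerProductSpace.toDual ℝ (Rn n)).symm (fderiv ℝ φ x), fun w => by
      rw [InnerProductSpace.toDual_symm_apply]⟩
  have hfc := hφ.continuous_fderiv (by simp)
  have hint : Integrable (fun z : Metric.sphere (0 : Rn n) 1 × Rn n =>
      inner ℝ v (z.1 : Rn n) * (u z.2 * (fderiv ℝ φ z.2 (-(z.1 : Rn n)))))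
      ((sphereMeasure n).prod volume) := by
    refine (integrable_sphere_prod_indicator hu (‖v‖ * L) R).mono' ?_ ?_
    · have : Continuous fun z : Metric.sphere (0 : Rn n) 1 × Rn n =>
          fderiv ℝ φ z.2 (-(z.1 : Rn n)) := by fun_prop
      have h2 := this.measurable
      exact Measurable.aestronglyMeasurable (by fun_prop)
    · refine Eventually.of_forall fun z => ?_
      rw [norm_mul, norm_mul, mul_comm ‖u z.2‖]
      by_cases hz : z.2 ∈ Metric.closedBall (0 : Rn n) R
      · rw [indicator_of_mem hz, mul_assoc]
        gcongr
        · exact abs_inner_sphere_le v z.1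
        · refine ((fderiv ℝ φ z.2).le_opNorm _).trans ?_
          rw [norm_neg, norm_sphere, mul_one]
          exact norm_fderiv_le_of_lipschitz ℝ hL
        · exact le_rfl
      · have : fderiv ℝ φ z.2 = 0 := by
          by_contra h
          exact hz (hR (support_fderiv_subset ℝ h))
        rw [indicator_of_notMem hz, this]
        simp
  convert hlim using 2
  rw [integral_prod_symm _ hint, ← integral_neg]
  congr 1; ext x
  obtain ⟨y, hy⟩ := hgrad x
  have hyβ : partialD β φ x = y β := by
    unfold partialD
    rw [hy]; simp [EuclideanSpace.inner_single_right]
  -- The choice of v turns the spherical average of ⟨v, ω⟩⟨∇φ(x), −ω⟩ into −∂_β φ(x).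
  rw [hyβ, ← hv y, ← neg_mul, ← integral_neg, ← integral_mul_const]
  congr 1; ext ω
  simp only [hy, inner_neg_right]
  ring

theorem ofReal_two_mul_abs_integral_le {α : Type*} [MeasurableSpace α] {μ : Measure α}
    {f b : α → ℝ} (h : ∀ z, 2 * |f z| ≤ b z) :
    ENNReal.ofReal (2 * |∫ z, f z ∂μ|) ≤ ∫⁻ z, ENNReal.ofReal (b z) ∂μ := by
  have h1 : 2 * |∫ z, f z ∂μ| = ‖∫ z, 2 * f z ∂μ‖ := by
    rw [integral_const_mul, norm_mul, Real.norm_eq_abs, Real.norm_eq_abs, abs_two]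
  rw [h1, ofReal_norm]
  refine (enorm_integral_le_lintegral_enorm _).trans (lintegral_mono fun z => ?_)
  rw [← ofReal_norm, norm_mul, Real.norm_eq_abs, Real.norm_eq_abs, abs_two]
  exact ENNReal.ofReal_le_ofReal (h z)

/-- Tonelli: the term in a picks up the total mass of σ, and the other term takes the order of
integration of the energy. -/
theorem lintegral_prod_ofReal_add_mul_le {S X : Type*} [MeasurableSpace S] [MeasurableSpace X]
    {σ : Measure S} [IsFiniteMeasure σ] {μ : Measure X} [SFinite μ] {a ψ : X → ℝ} {d : S × X → ℝ}
    (ha : Integrable a μ) (ha0 : ∀ x, 0 ≤ a x) (hψ : Measurable ψ) (hψ0 : ∀ x, 0 ≤ ψ x)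
    (ham : Measurable a) (hd : Measurable d) (hd0 : ∀ z, 0 ≤ d z) {c E : ℝ} (hc : 0 ≤ c)
    (hE0 : 0 ≤ E)
    (hE : ∫⁻ x, ENNReal.ofReal (ψ x) * ∫⁻ s, ENNReal.ofReal (d (s, x)) ∂σ ∂μ
      ≤ ENNReal.ofReal E) :
    ∫⁻ z, ENNReal.ofReal (c * (a z.2 + ψ z.2 * d z)) ∂(σ.prod μ)
      ≤ ENNReal.ofReal (c * σ.real univ * (∫ x, a x ∂μ) + c * E) := by
  have h1 : ∀ z : S × X, ENNReal.ofReal (c * (a z.2 + ψ z.2 * d z)) =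
      ENNReal.ofReal c * (ENNReal.ofReal (a z.2) +
        ENNReal.ofReal (ψ z.2) * ENNReal.ofReal (d z)) := by
    intro z
    rw [ENNReal.ofReal_mul hc, ENNReal.ofReal_add (ha0 _) (mul_nonneg (hψ0 _) (hd0 _)),
      ENNReal.ofReal_mul (hψ0 _)]
  simp only [h1]
  rw [lintegral_const_mul _ (by fun_prop), lintegral_add_left (by fun_prop),
    lintegral_prod_symm _ (by fun_prop), lintegral_prod_symm _ (by fun_prop)]
  simp only [lintegral_const]
  rw [lintegral_mul_const _ (by fun_prop)]
  have e1 : ∫⁻ x, ENNReal.ofReal (a x) ∂μ = ENNReal.ofReal (∫ x, a x ∂μ) :=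
    (ofReal_integral_eq_lintegral_ofReal ha (Eventually.of_forall ha0)).symm
  have e2 : σ univ = ENNReal.ofReal (σ.real univ) := (ofReal_measureReal (measure_ne_top _ _)).symm
  have e3 : ∫⁻ x, ∫⁻ s, ENNReal.ofReal (ψ x) * ENNReal.ofReal (d (s, x)) ∂σ ∂μ
      ≤ ENNReal.ofReal E := by
    refine le_trans (le_of_eq ?_) hE
    congr 1; ext x
    exact lintegral_const_mul _ (by fun_prop)
  have hI : 0 ≤ ∫ x, a x ∂μ := integral_nonneg ha0
  rw [e1, e2]
  calc _ ≤ ENNReal.ofReal c * (ENNReal.ofReal (∫ x, a x ∂μ) *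
        ENNReal.ofReal (σ.real univ) + ENNReal.ofReal E) := by gcongr
    _ = _ := by
      rw [← ENNReal.ofReal_mul hI, ← ENNReal.ofReal_add (by positivity) hE0,
        ← ENNReal.ofReal_mul hc]
      congr 1; ring

/-- A Korevaar–Schoen energy bound controls the distributional derivatives. -/
theorem two_mul_abs_integral_partialD_mul_le {u : Rn n → ℝ} (hum : Measurable u)
    (hu : LocallyIntegrable u) {φ : Rn n → ℝ} (hφ : ContDiff ℝ (⊤ : ℕ∞) φ)
    (hc : HasCompactSupport φ) {v : Rn n} {β : Fin n}
    (hv : ∀ y : Rn n, ∫ ω : Metric.sphere (0 : Rn n) 1,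
      inner ℝ v (ω : Rn n) * inner ℝ y (ω : Rn n) ∂(sphereMeasure n) = y β)
    {ψ : Rn n → ℝ} (hψ : Continuous ψ) (hψ0 : ∀ x, 0 ≤ ψ x) (hψ1 : ∀ x, φ x ≠ 0 → ψ x = 1)
    {E : ℝ} (hE0 : 0 ≤ E)
    (hE : ∀ᶠ ε in 𝓝[>] (0 : ℝ), ∫⁻ p, ENNReal.ofReal (ψ p) *
      ∫⁻ ω : Metric.sphere (0 : Rn n) 1,
        ENNReal.ofReal (((u (p + ε • (ω : Rn n)) - u p) / ε) ^ 2) ∂(sphereMeasure n)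
        ≤ ENNReal.ofReal E) :
    2 * |∫ x, partialD β φ x * u x| ≤
      ‖v‖ * (sphereMeasure n).real univ * (∫ x, φ x ^ 2) + ‖v‖ * E := by
  have hlim := (tendsto_integral_sphere_difference_quotient hum hu hφ hc hv).abs.const_mul 2
  rw [abs_neg] at hlim
  refine le_of_tendsto hlim ?_
  filter_upwards [hE] with ε hε
  rw [← (integral_sphere_difference_quotient hum hu hφ.continuous hc v ε)]
  have hφ2 : Integrable fun x => φ x ^ 2 := by
    have : HasCompactSupport fun x => φ x ^ 2 := HasCompactSupport.intro hc.isCompact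
      fun x hx => by rw [image_eq_zero_of_notMem_tsupport hx, zero_pow two_ne_zero]
    exact (hφ.continuous.fun_pow 2).integrable_of_hasCompactSupport this
  have hφm := hφ.continuous.measurable
  have hI : 0 ≤ ∫ x, φ x ^ 2 := integral_nonneg fun x => sq_nonneg _
  have hσ : 0 ≤ (sphereMeasure n).real univ := measureReal_nonneg
  have hv0 := norm_nonneg v
  have hR : 0 ≤ ‖v‖ * (sphereMeasure n).real univ * (∫ x, φ x ^ 2) + ‖v‖ * E :=
    add_nonneg (mul_nonneg (mul_nonneg hv0 hσ) hI) (mul_nonneg hv0 hE0)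
  have hdm : Measurable fun z : Metric.sphere (0 : Rn n) 1 × Rn n =>
    ((u (z.2 + ε • (z.1 : Rn n)) - u z.2) / ε) ^ 2 := by fun_prop
  refine (ENNReal.ofReal_le_ofReal_iff hR).1 (le_trans (ofReal_two_mul_abs_integral_le ?_)
    (lintegral_prod_ofReal_add_mul_le hφ2 (fun x => sq_nonneg _) hψ.measurable hψ0
      (hφm.pow_const 2) hdm (fun z => sq_nonneg _) hv0 hE0 hε))
  intro z
  set D := (u (z.2 + ε • (z.1 : Rn n)) - u z.2) / ε
  -- Young's inequality; the weight ψ is 1 wherever φ ≠ 0, so it costs nothing.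
  have h2 : 2 * (|φ z.2| * |D|) ≤ φ z.2 ^ 2 + ψ z.2 * D ^ 2 := by
    by_cases h0 : φ z.2 = 0
    · rw [h0]
      have := mul_nonneg (hψ0 z.2) (sq_nonneg D)
      simpa using this
    · rw [hψ1 _ h0, one_mul, ← sq_abs (φ z.2), ← sq_abs D]
      nlinarith [sq_nonneg (|φ z.2| - |D|)]
  rw [abs_mul, abs_mul, mul_left_comm]
  exact mul_le_mul (abs_inner_sphere_le v z.1) h2 (by positivity) hv0

end KorevaarSchoen

/-! ### The weak gradient of the horizontal component -/

section Existence

variable {n m : ℕ}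

/-- The fourth power of the gauge is |z|⁴ + t² ≥ |z|⁴, and the group law is additive in z. -/
theorem norm_fst_sub_le_kdist (p q : Heis m) : ‖q.1 - p.1‖ ≤ Heis.kdist p q := by
  unfold Heis.kdist Heis.gauge
  have h1 : (Heis.mul (Heis.inv p) q).1 = q.1 - p.1 := by
    simp only [Heis.mul, Heis.inv]; abel
  rw [h1]
  set a := ‖q.1 - p.1‖
  have ha : 0 ≤ a := norm_nonneg _
  calc a = ((a ^ 2) ^ 2) ^ (1 / 4 : ℝ) := by
        rw [← pow_mul, ← Real.rpow_natCast, ← Real.rpow_mul ha]; norm_num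
    _ ≤ _ := by
        refine Real.rpow_le_rpow (by positivity) ?_ (by norm_num)
        linarith [sq_nonneg (Heis.mul (Heis.inv p) q).2]

/-- Scalar functions dominated by a map of finite Korevaar–Schoen energy have weak derivatives
in `L²`. -/
theorem exists_weak_partial_of_ksEnergy {f : Rn n → Heis m} {V : Set (Rn n)} (hV : IsOpen V)
    (hE : ksEnergy f V < ∞) {u : Rn n → ℝ} (hum : Measurable u) (hu : LocallyIntegrable u)
    (hle : ∀ p q, |u q - u p| ≤ Heis.kdist (f p) (f q)) (β : Fin n) :
    ∃ g : Rn n → ℝ, MemLp g 2 ∧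
      ∀ φ : Rn n → ℝ, ContDiff ℝ (⊤ : ℕ∞) φ → HasCompactSupport φ → tsupport φ ⊆ V →
        ∫ x, partialD β φ x * u x = - ∫ x, φ x * g x := by
  obtain ⟨v, hv⟩ := exists_integral_sphere_inner_mul_inner β
  refine exists_weak_partial_of_bound hu β (A := ‖v‖ * (sphereMeasure n).real univ)
    (B := ‖v‖ * ((ksEnergy f V).toReal + 1)) fun φ hφ hc hs => ?_
  -- The intermediate compact set keeps the support of ψ inside V, making ψ admissible in the
  -- supremum defining the energy.
  obtain ⟨K, hK, hK1, hK2⟩ := exists_compact_between hc.isCompact hV hs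
  obtain ⟨ψ, hψ1, hψ0, hψc, hψI⟩ := exists_continuous_one_zero_of_isCompact hc.isCompact
    isOpen_interior.isClosed_compl (disjoint_compl_right_iff_subset.2 hK1)
  have hψs : Function.support ψ ⊆ K := fun x hx => by
    by_contra h
    exact hx (hψ0 fun h' => h (interior_subset h'))
  have hψV : tsupport ψ ⊆ V := (closure_minimal hψs hK.isClosed).trans hK2
  -- The extra 1 gives a strict inequality, which then holds for all small ε.
  have hlim : limsup (fun ε : ℝ => ∫⁻ p in V, ENNReal.ofReal (ψ p) * ksDensity f ε p) (𝓝[>] 0)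
      < ENNReal.ofReal ((ksEnergy f V).toReal + 1) := by
    refine lt_of_le_of_lt (b := ksEnergy f V) ?_ ?_
    · unfold ksEnergy
      exact le_iSup_of_le ψ (le_iSup_of_le ψ.continuous (le_iSup_of_le hψc (le_iSup_of_le hψV
        (le_iSup_of_le hψI le_rfl))))
    · rw [ENNReal.lt_ofReal_iff_toReal_lt hE.ne]
      linarith
  refine two_mul_abs_integral_partialD_mul_le hum hu hφ hc hv ψ.continuous (fun x => (hψI x).1)
    (fun x hx => hψ1 (subset_tsupport φ hx)) (by positivity) ?_
  filter_upwards [eventually_lt_of_limsup_lt hlim, self_mem_nhdsWithin] with ε hε hε0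
  refine le_trans ?_ hε.le
  rw [← lintegral_indicator hV.measurableSet]
  refine lintegral_mono fun p => ?_
  by_cases hp : p ∈ V
  · rw [indicator_of_mem hp]
    refine mul_le_mul_right (lintegral_mono fun ω => ENNReal.ofReal_le_ofReal ?_) _
    have hε' : 0 < ε := hε0
    rw [← sq_abs, abs_div, abs_of_pos hε']
    gcongr
    exact hle _ _
  · have : ψ p = 0 := by
      by_contra h
      exact hp (hψV (subset_tsupport ψ h))
    simp [this]

/-- An identity between vector valued integrals holds if it holds for real and imaginary parts of
the components. -/
theorem integral_smul_eq_neg_integral_smul {w H : Rn n → EuclideanSpace ℂ (Fin m)} {a b : Rn n → ℝ}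
    (i1 : Integrable fun x => a x • w x) (i2 : Integrable fun x => b x • H x)
    (hre : ∀ k, ∫ x, a x * (w x k).re = - ∫ x, b x * (H x k).re)
    (him : ∀ k, ∫ x, a x * (w x k).im = - ∫ x, b x * (H x k).im) :
    ∫ x, a x • w x = - ∫ x, b x • H x := by
  ext k
  let π : EuclideanSpace ℂ (Fin m) →L[ℝ] ℂ :=
    (EuclideanSpace.proj k : EuclideanSpace ℂ (Fin m) →L[ℂ] ℂ).restrictScalars ℝ
  have e : ∀ {c : Rn n → ℝ} {W : Rn n → EuclideanSpace ℂ (Fin m)},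
      Integrable (fun x => c x • W x) →
      (π (∫ x, c x • W x)).re = ∫ x, c x * (W x k).re ∧
      (π (∫ x, c x • W x)).im = ∫ x, c x * (W x k).im := by
    intro c W hi
    have h1 := (Complex.reCLM ∘L π).integral_comp_comm hi
    have h2 := (Complex.imCLM ∘L π).integral_comp_comm hi
    refine ⟨h1.symm.trans (integral_congr_ae (Eventually.of_forall fun x => ?_)),
      h2.symm.trans (integral_congr_ae (Eventually.of_forall fun x => ?_))⟩
    · simp [π]
    · simp [π]
  change π (∫ x, a x • w x) = π (- ∫ x, b x • H x)
  rw [map_neg]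
  apply Complex.ext
  · rw [Complex.neg_re, (e i1).1, (e i2).1, hre]
  · rw [Complex.neg_im, (e i1).2, (e i2).2, him]

/-- The vector field with given real and imaginary parts of its components. -/
noncomputable def ofReIm (a b : Fin m → Rn n → ℝ) (x : Rn n) : EuclideanSpace ℂ (Fin m) :=
  WithLp.toLp 2 fun k => (a k x : ℂ) + b k x * Complex.I

theorem ofReIm_re (a b : Fin m → Rn n → ℝ) (x : Rn n) (k : Fin m) :
    (ofReIm a b x k).re = a k x := by
  simp [ofReIm]

theorem ofReIm_im (a b : Fin m → Rn n → ℝ) (x : Rn n) (k : Fin m) :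
    (ofReIm a b x k).im = b k x := by
  simp [ofReIm]

theorem memLp_ofReIm {a b : Fin m → Rn n → ℝ} (ha : ∀ k, MemLp (a k) 2)
    (hb : ∀ k, MemLp (b k) 2) : MemLp (ofReIm a b) 2 := by
  have hsum : ofReIm a b = fun x => ∑ k, (a k x • EuclideanSpace.single k (1 : ℂ)
      + b k x • EuclideanSpace.single k Complex.I) := by
    ext x k
    simp [ofReIm, Pi.single_apply, Finset.sum_add_distrib]
  rw [hsum]
  have hs : ∀ {c : Rn n → ℝ} (e : EuclideanSpace ℂ (Fin m)), MemLp c 2 →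
      MemLp (fun x => c x • e) 2 := fun e hc =>
    (ContinuousLinearMap.toSpanSingleton ℝ e).comp_memLp' hc
  exact memLp_finsetSum _ fun k _ => (hs _ (ha k)).add (hs _ (hb k))

/-- The `z`-component of a map of finite Korevaar–Schoen energy on `V` has a weak gradient in `L²`
on `V`. -/
theorem exists_weak_gradient_of_ksEnergy {f : Rn n → Heis m} {V : Set (Rn n)} (hV : IsOpen V)
    (hE : ksEnergy f V < ∞) (hfm : Measurable f)
    (hz : LocallyIntegrable fun x => (f x).1) :
    ∃ G : Rn n → Fin n → EuclideanSpace ℂ (Fin m), (∀ β, MemLp (fun x => G x β) 2) ∧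
      ∀ φ : Rn n → ℝ, ContDiff ℝ (⊤ : ℕ∞) φ → HasCompactSupport φ → tsupport φ ⊆ V → ∀ β,
        ∫ x, partialD β φ x • (f x).1 = - ∫ x, φ x • G x β := by
  have hcomp : ∀ (k : Fin m) (p q : Rn n), ‖(f q).1 k - (f p).1 k‖ ≤ Heis.kdist (f p) (f q) :=
    fun k p q => (PiLp.norm_apply_le ((f q).1 - (f p).1) k).trans (norm_fst_sub_le_kdist _ _)
  have hzk : ∀ k : Fin m, LocallyIntegrable fun x => (f x).1 k := fun k =>
    hz.mono ((EuclideanSpace.proj k : EuclideanSpace ℂ (Fin m) →L[ℂ] ℂ).continuous.comp_aestronglyMeasurable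
      hz.aestronglyMeasurable) (Eventually.of_forall fun x => PiLp.norm_apply_le _ k)
  have hmk : ∀ k : Fin m, Measurable fun x => (f x).1 k := fun k =>
    (EuclideanSpace.proj k : EuclideanSpace ℂ (Fin m) →L[ℂ] ℂ).continuous.measurable.comp hfm.fst
  have hre := fun (β : Fin n) (k : Fin m) => exists_weak_partial_of_ksEnergy hV hE
    (u := fun x => ((f x).1 k).re) (Complex.measurable_re.comp (hmk k))
    ((hzk k).mono (Complex.continuous_re.comp_aestronglyMeasurable (hzk k).aestronglyMeasurable)
      (Eventually.of_forall fun x => Complex.abs_re_le_norm _))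
    (fun p q => (by rw [← Complex.sub_re]; exact (Complex.abs_re_le_norm _).trans (hcomp k p q))) β
  have him := fun (β : Fin n) (k : Fin m) => exists_weak_partial_of_ksEnergy hV hE
    (u := fun x => ((f x).1 k).im) (Complex.measurable_im.comp (hmk k))
    ((hzk k).mono (Complex.continuous_im.comp_aestronglyMeasurable (hzk k).aestronglyMeasurable)
      (Eventually.of_forall fun x => Complex.abs_im_le_norm _))
    (fun p q => (by rw [← Complex.sub_im]; exact (Complex.abs_im_le_norm _).trans (hcomp k p q))) β
  choose gr hgr hgr' using hre
  choose gi hgi hgi' using him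
  have hG : ∀ β, MemLp (ofReIm (gr β) (gi β)) 2 volume := fun β => memLp_ofReIm (hgr β) (hgi β)
  refine ⟨fun x β => ofReIm (gr β) (gi β) x, hG, fun φ hφ hc hs β => ?_⟩
  refine integral_smul_eq_neg_integral_smul
    (hz.integrable_smul_left_of_hasCompactSupport (continuous_partialD hφ β)
      (hasCompactSupport_partialD hc β))
    (((hG β).locallyIntegrable one_le_two).integrable_smul_left_of_hasCompactSupport
      hφ.continuous hc) (fun k => ?_) fun k => ?_
  · simp only [ofReIm_re]
    exact hgr' β k φ hφ hc hs
  · simp only [ofReIm_im]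
    exact hgi' β k φ hφ hc hs

theorem MemL2Heis.measurableSet_inter_preimage {f : Rn n → Heis m} {V : Set (Rn n)}
    (hf : MemL2Heis f V) (hV : MeasurableSet V) {s : Set (Heis m)} (hs : MeasurableSet s) :
    MeasurableSet (V ∩ f ⁻¹' s) := by
  have := hV.subtype_image (hf.1 hs)
  convert this using 1
  ext x
  simp [and_comm]

/-- The distance to P₀ dominates |z − z(P₀)|, which is therefore in L², hence in L¹ on a compact
set; the constant is then added back. -/
theorem MemL2Heis.integrableOn_fst {f : Rn n → Heis m} {V : Set (Rn n)}
    (hf : MemL2Heis f V) (hfm : Measurable f) {K : Set (Rn n)} (hK : IsCompact K) (hKV : K ⊆ V) :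
    IntegrableOn (fun x => (f x).1) K := by
  obtain ⟨-, P, hP⟩ := hf
  have : IsFiniteMeasure (volume.restrict K) := ⟨by simpa using hK.measure_lt_top⟩
  have hm : Measurable fun x => (f x).1 - P.1 := hfm.fst.sub_const _
  have h2 : MemLp (fun x => (f x).1 - P.1) 2 (volume.restrict K) := by
    rw [memLp_two_iff_integrable_sq_norm hm.aestronglyMeasurable]
    refine ⟨(hm.norm.pow_const 2).aestronglyMeasurable, ?_⟩
    rw [hasFiniteIntegral_iff_ofReal (Eventually.of_forall fun x => sq_nonneg _)]
    refine lt_of_le_of_lt (lintegral_mono_set hKV) (lt_of_le_of_lt (lintegral_mono fun x => ?_) hP)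
    refine ENNReal.ofReal_le_ofReal ?_
    rw [norm_sub_rev]
    exact pow_le_pow_left₀ (norm_nonneg _) (norm_fst_sub_le_kdist _ _) 2
  have h3 := (h2.integrable one_le_two).add (integrable_const P.1)
  exact h3.congr (Eventually.of_forall fun x => by simp)

theorem integrable_gradSq {G : Rn n → Fin n → EuclideanSpace ℂ (Fin m)}
    (hG : ∀ β, MemLp (fun x => G x β) 2) : Integrable (gradSq G) := by
  have : gradSq G = fun x => ∑ β, ‖G x β‖ ^ 2 := by
    ext x
    simp only [gradSq, gradSqComp, EuclideanSpace.norm_sq_eq]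
    exact Finset.sum_comm
  rw [this]
  exact integrable_finsetSum _ fun β _ => (hG β).integrable_norm_pow two_ne_zero

theorem exists_hasWeakGradient_of_memW12 {f : Rn n → Heis m} (hf : MemW12 f univ) :
    ∃ G : Rn n → Fin n → EuclideanSpace ℂ (Fin m),
      HasWeakGradient (fun x => (f x).1) G ∧ Integrable (gradSq G) := by
  have hfm : Measurable f := fun s hs => by
    simpa using hf.1.measurableSet_inter_preimage MeasurableSet.univ hs
  have hz : LocallyIntegrable fun x => (f x).1 := locallyIntegrable_iff.2 fun K hK =>
    hf.1.integrableOn_fst hfm hK (subset_univ K)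
  obtain ⟨G, hG, hG'⟩ := exists_weak_gradient_of_ksEnergy isOpen_univ hf.2 hfm hz
  exact ⟨G, ⟨hz, fun β => (hG β).locallyIntegrable one_le_two,
    fun φ hφ hc β => hG' φ hφ hc (subset_univ _) β⟩, integrable_gradSq hG⟩

theorem exists_hasWeakGradient_of_memW12Loc {f : Rn n → Heis m} (hf : MemW12Loc f) :
    ∃ G : Rn n → Fin n → EuclideanSpace ℂ (Fin m),
      HasWeakGradient (fun x => (f x).1) G ∧ LocallyIntegrable (gradSq G) := by
  have hB : ∀ j : ℕ, MemW12 f (Metric.ball 0 (j + 1)) := fun j =>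
    hf _ Metric.isOpen_ball Metric.isBounded_ball
  have hcov : ∀ K : Set (Rn n), IsCompact K → ∃ j : ℕ, K ⊆ Metric.ball 0 ((j : ℝ) + 1) := by
    intro K hK
    obtain ⟨R, hR⟩ := hK.isBounded.subset_closedBall (0 : Rn n)
    obtain ⟨j, hj⟩ := exists_nat_gt R
    exact ⟨j, hR.trans (Metric.closedBall_subset_ball (by linarith))⟩
  have hfm : Measurable f := by
    intro s hs
    have : f ⁻¹' s = ⋃ j : ℕ, Metric.ball (0 : Rn n) ((j : ℝ) + 1) ∩ f ⁻¹' s := by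
      rw [← iUnion_inter, eq_comm, inter_eq_right]
      intro x _
      obtain ⟨j, hj⟩ := hcov {x} isCompact_singleton
      exact mem_iUnion.2 ⟨j, hj rfl⟩
    rw [this]
    exact MeasurableSet.iUnion fun j =>
      (hB j).1.measurableSet_inter_preimage Metric.isOpen_ball.measurableSet hs
  have hz : LocallyIntegrable fun x => (f x).1 := locallyIntegrable_iff.2 fun K hK => by
    obtain ⟨j, hj⟩ := hcov K hK
    exact (hB j).1.integrableOn_fst hfm hK hj
  choose G hG hG' using fun j : ℕ =>
    exists_weak_gradient_of_ksEnergy Metric.isOpen_ball (hB j).2 hfm hz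
  have hGl : ∀ j β, LocallyIntegrable fun x => G j x β := fun j β =>
    (hG j β).locallyIntegrable one_le_two
  -- Gradients built on different balls agree a.e. on the overlap, by the fundamental lemma of the
  -- calculus of variations.
  have huniq : ∀ i j : ℕ, ∀ β, ∀ᵐ x, x ∈ Metric.ball (0 : Rn n) ((i : ℝ) + 1) ∩
      Metric.ball (0 : Rn n) ((j : ℝ) + 1) → G i x β - G j x β = 0 := by
    intro i j β
    refine (Metric.isOpen_ball.inter Metric.isOpen_ball).ae_eq_zero_of_integral_contDiff_smul_eq_zero
      (((hGl i β).sub (hGl j β)).locallyIntegrableOn _) fun φ hφ hc hs => ?_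
    have e1 := hG' i φ hφ hc (hs.trans inter_subset_left) β
    have e2 := hG' j φ hφ hc (hs.trans inter_subset_right) β
    simp only [smul_sub]
    rw [integral_sub, sub_eq_zero, ← neg_inj, ← e1, ← e2]
    · exact (hGl i β).integrable_smul_left_of_hasCompactSupport hφ.continuous hc
    · exact (hGl j β).integrable_smul_left_of_hasCompactSupport hφ.continuous hc
  -- The point x lies in the ball of radius ⌈‖x‖⌉ + 1, so this index always selects a gradient valid
  -- at x.
  set H : Rn n → Fin n → EuclideanSpace ℂ (Fin m) := fun x => G ⌈‖x‖⌉₊ x with hH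
  have hHG : ∀ j : ℕ, ∀ᵐ x, x ∈ Metric.ball (0 : Rn n) ((j : ℝ) + 1) → H x = G j x := by
    intro j
    have := ae_all_iff.2 fun i : ℕ => ae_all_iff.2 fun β => huniq i j β
    filter_upwards [this] with x hx hxj
    ext1 β
    refine sub_eq_zero.1 (hx _ β ⟨?_, hxj⟩)
    rw [mem_ball_zero_iff]
    linarith [Nat.le_ceil ‖x‖]
  refine ⟨H, ⟨hz, fun β => locallyIntegrable_iff.2 fun K hK => ?_, fun φ hφ hc β => ?_⟩,
    locallyIntegrable_iff.2 fun K hK => ?_⟩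
  · obtain ⟨j, hj⟩ := hcov K hK
    refine ((hGl j β).integrableOn_isCompact hK).congr ?_
    filter_upwards [ae_restrict_of_ae (hHG j), ae_restrict_mem hK.measurableSet] with x hx hxK
    rw [hx (hj hxK)]
  · obtain ⟨j, hj⟩ := hcov _ hc.isCompact
    rw [hG' j φ hφ hc hj β]
    congr 1
    refine integral_congr_ae ?_
    filter_upwards [hHG j] with x hx
    by_cases hxs : x ∈ tsupport φ
    · rw [hx (hj hxs)]
    · rw [image_eq_zero_of_notMem_tsupport hxs, zero_smul, zero_smul]
  · obtain ⟨j, hj⟩ := hcov K hK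
    refine (integrable_gradSq (hG j)).integrableOn.congr ?_
    filter_upwards [ae_restrict_of_ae (hHG j), ae_restrict_mem hK.measurableSet] with x hx hxK
    simp only [gradSq, gradSqComp, hx (hj hxK)]

/-- Uniqueness of weak derivatives, which carries the integrability of the constructed gradient over
to an arbitrary one. -/
theorem HasWeakGradient.ae_eq {z : Rn n → EuclideanSpace ℂ (Fin m)}
    {G H : Rn n → Fin n → EuclideanSpace ℂ (Fin m)} (hG : HasWeakGradient z G)
    (hH : HasWeakGradient z H) : gradSq G =ᵐ[volume] gradSq H := by
  have : ∀ β, ∀ᵐ x, G x β = H x β := fun β =>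
    ae_eq_of_integral_contDiff_smul_eq (hG.2.1 β) (hH.2.1 β) fun φ hφ hc => by
      rw [← neg_inj, ← hG.2.2 φ hφ hc β, ← hH.2.2 φ hφ hc β]
  filter_upwards [ae_all_iff.2 this] with x hx
  simp only [gradSq, gradSqComp, hx]

theorem HasWeakGradient.aestronglyMeasurable {z : Rn n → EuclideanSpace ℂ (Fin m)}
    {G : Rn n → Fin n → EuclideanSpace ℂ (Fin m)} (hG : HasWeakGradient z G) (β : Fin n)
    (k : Fin m) : AEStronglyMeasurable (fun x => G x β k) volume :=
  (EuclideanSpace.proj k : EuclideanSpace ℂ (Fin m) →L[ℂ] ℂ).continuous.comp_aestronglyMeasurable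
    (hG.2.1 β).aestronglyMeasurable

end Existence
-- The Liouville theorem
theorem mainTheorem11 (n m : ℕ) (f : Rn n → Heis m) :
    (MemW12Loc f →
      (∃ G : Rn n → Fin n → EuclideanSpace ℂ (Fin m),
        HasWeakGradient (fun x => (f x).1) G ∧ LocallyIntegrable (gradSq G)) ∧
      ∀ G : Rn n → Fin n → EuclideanSpace ℂ (Fin m),
        HasWeakGradient (fun x => (f x).1) G →
        SolvesEulerLagrange G →
        Tendsto (fun r : ℝ => 1 / r ^ ((n : ℤ) - 2) * ∫ x in Metric.ball (0 : Rn n) r, gradSq G x)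
          atTop (𝓝 0) →
        ∀ᵐ x, gradSq G x = 0) ∧
    (n ≠ 2 ∨ m ≤ 1 → MemW12 f univ →
      (∃ G : Rn n → Fin n → EuclideanSpace ℂ (Fin m),
        HasWeakGradient (fun x => (f x).1) G ∧ Integrable (gradSq G)) ∧
      ∀ G : Rn n → Fin n → EuclideanSpace ℂ (Fin m),
        HasWeakGradient (fun x => (f x).1) G →
        SolvesEulerLagrange G →
        ∀ᵐ x, gradSq G x = 0)
 := by
  refine ⟨fun hf => ?_, fun hnm hf => ?_⟩
  · obtain ⟨G₀, hG₀, he₀⟩ := exists_hasWeakGradient_of_memW12Loc hf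
    refine ⟨⟨G₀, hG₀, he₀⟩, fun G hG hEL hlim => ?_⟩
    have hae := hG₀.ae_eq hG
    have he : LocallyIntegrable (gradSq G) := he₀.mono
      (gradSq_aestronglyMeasurable hG.aestronglyMeasurable) (hae.mono fun x hx => by rw [hx])
    exact hEL.gradSq_eq_zero_of_tendsto hG.aestronglyMeasurable he hlim
  · obtain ⟨G₀, hG₀, he₀⟩ := exists_hasWeakGradient_of_memW12 hf
    refine ⟨⟨G₀, hG₀, he₀⟩, fun G hG hEL => ?_⟩
    -- Finite Korevaar–Schoen energy enters the vanishing argument only through this integrability.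
    have he : Integrable (gradSq G) := he₀.congr (hG₀.ae_eq hG)
    by_cases hn : n = 2
    · subst hn
      exact hEL.gradSq_eq_zero_of_two hG.aestronglyMeasurable he
        (hnm.resolve_left (not_not.2 rfl))
    · exact hEL.gradSq_eq_zero_of_ne_two hG.aestronglyMeasurable he hn
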